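/- Let $\nu>0$ and let $u,B:\mathbb R^3\to\mathbb R^3$ be vector fields of class $C^2$ that solve the stationary Hall-MHD system, that is, for some differentiable pressure $p:\mathbb R^3\to\mathbb R$ the following equations hold at every point of $\mathbb R^3$: $$(u\cdot\nabla)u+\nabla p=(\nabla\times B)\times B+\nu\Delta u,\qquad \nabla\cdot u=0,$$ $$-\nabla\times(u\times B)+\nabla\times\big((\nabla\times B)\times B\big)=\Delta B,\qquad \nabla\cdot B=0.$$ Suppose that $$\int_{\mathbb R^3}|\nabla u|^2\,dx+\int_{\mathbb R^3}|\nabla B|^2\,dx<\infty\qquad\text{and}\qquad u,B\in L^\infty(\mathbb R^3)\cap L^{9/2}(\mathbb R^3).$$ Then $u=0$ and $B=0$ on $\mathbb R^3$. -/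

import Mathlib

open MeasureTheory
open scoped ENNReal

noncomputable section

/-- Three-dimensional Euclidean space. -/
abbrev E3 : Type := EuclideanSpace ℝ (Fin 3)

/-- The `j`-th partial derivative at `x` of the `i`-th component of the vector field `v`. -/
def partialD (v : E3 → E3) (j i : Fin 3) (x : E3) : ℝ :=
  (fderiv ℝ v x (EuclideanSpace.single j 1)) i

/-- The cross product of two vectors of Euclidean space. -/
def cross (a b : E3) : E3 :=
  WithLp.toLp 2 (crossProduct (WithLp.ofLp a) (WithLp.ofLp b))

/-- The divergence `∇ · v`. -/
def divergence (v : E3 → E3) (x : E3) : ℝ :=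
  ∑ i : Fin 3, partialD v i i x

/-- The curl `∇ × v`. -/
def curl (v : E3 → E3) (x : E3) : E3 :=
  !₂[partialD v 1 2 x - partialD v 2 1 x,
     partialD v 2 0 x - partialD v 0 2 x,
     partialD v 0 1 x - partialD v 1 0 x]

/-- The convection term `(w · ∇) v`. -/
def convection (w v : E3 → E3) (x : E3) : E3 :=
  ∑ j : Fin 3, (w x j) • fderiv ℝ v x (EuclideanSpace.single j 1)

/-- The squared Frobenius norm `|∇v|²` of the gradient of `v`. -/
def gradNormSq (v : E3 → E3) (x : E3) : ℝ :=
  ∑ i : Fin 3, ∑ j : Fin 3, (partialD v j i x) ^ 2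

/-- `(u, B)` is a classical `C²` solution on the whole space of the stationary Hall-MHD system with
viscosity `ν`, for some pressure `p`. The pressure is a differentiable scalar function; by the
momentum equation it is then automatically `C¹`. -/
structure IsStationaryHallMHDSolution (ν : ℝ) (u B : E3 → E3) : Prop where
  contDiff_u : ContDiff ℝ 2 u
  contDiff_B : ContDiff ℝ 2 B
  momentum : ∃ p : E3 → ℝ, Differentiable ℝ p ∧ ∀ x : E3,
    convection u u x + gradient p x = cross (curl B x) (B x) + ν • Laplacian.laplacian u x
  div_u : ∀ x : E3, divergence u x = 0
  induction_eq : ∀ x : E3,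
    -curl (fun y => cross (u y) (B y)) x + curl (fun y => cross (curl B y) (B y)) x
      = Laplacian.laplacian B x
  div_B : ∀ x : E3, divergence B x = 0

end

/-! The proof is a local energy argument. Let J be the curl of B, and let T be the stress tensor
without pressure, so that the momentum equation reads ∇p = -div T. Pairing the equations with u and
B gives `HallComponents.sum_pd_flux`: ν|∇u|² + |∇B|² is the divergence of a flux plus u · div T. The
Hall term does no work since J × B is orthogonal to J, and the work of the Lorentz force cancels
against that of u × B. After multiplication by a cutoff σ at scale R, the flux is needed only on an
annulus, where it is bounded by |(u,B)|³ + |(u,B)||∇(u,B)| + |(u,B)|²|∇(u,B)|.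

What remains is ∫ σ u · div T, the pressure term. No bound for p is used. Instead ∇p is tested
against fields of the form div A with A antisymmetric and compactly supported, to which every
gradient is orthogonal. With g = σu and a Newtonian potential N, take A_ij = χ(∂_i N g_j - ∂_j N
g_i), where χ is a wider cutoff. Its divergence is a multiple of g plus an error w containing only
N(∇σ · u) and terms with ∇χ. Hence ∫ g · div T is controlled by ∫ T : ∇w
(`abs_integral_cutoff_mul_le`). Second derivatives of N are bounded in L² by integration by parts,
first derivatives by Hardy's inequality, so no singular integrals occur. The kernel is regularized
as (|y|² + ε²)^(-1/2); all final constants are independent of ε, and ε tends to 0. In each product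
of the resulting bound at least one factor lives on the annulus.

By Hölder's inequality the local L² norms of |(u,B)| and |(u,B)|² are at most q^(2/9) R^(5/6) and
q^(4/9) R^(1/6) up to constants, where q is the local integral of |(u,B)|^(9/2). Their product is
exactly of order R, the size of the factor 1/R from the cutoff. The terms with q on the annulus
vanish because the tails of a convergent integral do; the single remaining term, global gradient
norm times global field norm, gains R^(-1/6). Hence the gradients vanish
(`HallComponents.gradient_eq_zero`), and a constant field in L^(9/2) is zero. -/

/-- The `j`-th partial derivative of a scalar function on Euclidean space. -/
noncomputable def pd (j : Fin 3) (f : E3 → ℝ) (x : E3) : ℝ :=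
  fderiv ℝ f x (EuclideanSpace.single j 1)

/-! ### Calculus of scalar partial derivatives. -/

section PartialDerivatives

variable {f g : E3 → ℝ} {x : E3} (j : Fin 3)

theorem pd_add (hf : DifferentiableAt ℝ f x) (hg : DifferentiableAt ℝ g x) :
    pd j (fun y => f y + g y) x = pd j f x + pd j g x := by
  simp only [pd]; rw [fderiv_fun_add hf hg]; rfl

theorem pd_sub (hf : DifferentiableAt ℝ f x) (hg : DifferentiableAt ℝ g x) :
    pd j (fun y => f y - g y) x = pd j f x - pd j g x := by
  simp only [pd]; rw [fderiv_fun_sub hf hg]; rfl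

theorem pd_mul (hf : DifferentiableAt ℝ f x) (hg : DifferentiableAt ℝ g x) :
    pd j (fun y => f y * g y) x = pd j f x * g x + f x * pd j g x := by
  simp only [pd]; rw [fderiv_fun_mul hf hg]; simp; ring

theorem pd_const_mul (c : ℝ) (hf : DifferentiableAt ℝ f x) :
    pd j (fun y => c * f y) x = c * pd j f x := by
  simp only [pd]; rw [fderiv_const_mul hf]; rfl

theorem pd_neg : pd j (fun y => - f y) x = - pd j f x := by
  simp only [pd]; rw [fderiv_fun_neg]; rfl

theorem pd_sum {ι : Type*} (s : Finset ι) {F : ι → E3 → ℝ}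
    (hF : ∀ i ∈ s, DifferentiableAt ℝ (F i) x) :
    pd j (fun y => ∑ i ∈ s, F i y) x = ∑ i ∈ s, pd j (F i) x := by
  simp only [pd]; rw [fderiv_fun_sum hF]; simp

theorem ContDiff.pd_of_le {m n : WithTop ℕ∞} (hf : ContDiff ℝ n f) (hmn : m + 1 ≤ n) :
    ContDiff ℝ m (pd j f) :=
  (hf.fderiv_right hmn).clm_apply contDiff_const

theorem ContDiff.pd_one (hf : ContDiff ℝ 2 f) : ContDiff ℝ 1 (pd j f) :=
  hf.pd_of_le j (by norm_num)

theorem ContDiff.continuous_pd (hf : ContDiff ℝ 1 f) : Continuous (pd j f) :=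
  (hf.pd_of_le (m := 0) j (by norm_num)).continuous

theorem pd_comm (hf : ContDiff ℝ 2 f) (k : Fin 3) : pd k (pd j f) x = pd j (pd k f) x := by
  have hd : DifferentiableAt ℝ (fderiv ℝ f) x :=
    ((hf.fderiv_right (m := 1) (by norm_num)).differentiable (by norm_num)) x
  have h : ∀ a b : Fin 3, pd a (pd b f) x
      = fderiv ℝ (fderiv ℝ f) x (EuclideanSpace.single a 1) (EuclideanSpace.single b 1) := by
    intro a b
    have : pd b f = fun y => fderiv ℝ f y (EuclideanSpace.single b 1) := rfl
    rw [this, pd, fderiv_clm_apply hd (differentiableAt_const _)]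
    simp
  rw [h, h]
  exact (hf.contDiffAt.isSymmSndFDerivAt (by simp)).eq _ _

theorem HasCompactSupport.pd (hf : HasCompactSupport f) : HasCompactSupport (pd j f) :=
  hf.fderiv_apply (𝕜 := ℝ) _

theorem pd_eq_zero_of_eventuallyEq {c : ℝ} (h : f =ᶠ[nhds x] fun _ => c) : pd j f x = 0 := by
  rw [pd, h.fderiv_eq]; simp

end PartialDerivatives

/-! ### Integration by parts and the Cauchy-Schwarz inequality. -/

section IntegrationByParts

variable {f g : E3 → ℝ} (j : Fin 3)

theorem integral_mul_pd_of_integrable (hf : Differentiable ℝ f) (hg : Differentiable ℝ g)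
    (h1 : Integrable (fun x => pd j f x * g x)) (h2 : Integrable (fun x => f x * pd j g x))
    (h3 : Integrable (fun x => f x * g x)) :
    ∫ x, f x * pd j g x = - ∫ x, pd j f x * g x :=
  integral_mul_fderiv_eq_neg_fderiv_mul_of_integrable h1 h2 h3 (fun x _ => hf x) (fun x _ => hg x)

/-- All integrability comes from the compact support of `g`; `f` needs no decay and only one
continuous partial derivative, so the pressure is admissible as `f`. -/
theorem integral_mul_pd (hf : Differentiable ℝ f) (hf' : Continuous (pd j f))
    (hg : ContDiff ℝ 1 g) (hgc : HasCompactSupport g) :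
    ∫ x, f x * pd j g x = - ∫ x, pd j f x * g x := by
  refine integral_mul_pd_of_integrable j hf (hg.differentiable (by norm_num)) ?_ ?_ ?_
  · exact (hf'.mul hg.continuous).integrable_of_hasCompactSupport hgc.mul_left
  · exact (hf.continuous.mul (hg.continuous_pd j)).integrable_of_hasCompactSupport
      (hgc.pd j).mul_left
  · exact (hf.continuous.mul hg.continuous).integrable_of_hasCompactSupport hgc.mul_left

end IntegrationByParts

/-- The Cauchy-Schwarz inequality for integrals of real functions. -/
theorem abs_integral_mul_le_sqrt_mul_sqrt {α : Type*} [MeasurableSpace α] {μ : Measure α}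
    {f g : α → ℝ} (hf : MemLp f 2 μ) (hg : MemLp g 2 μ) :
    |∫ x, f x * g x ∂μ| ≤ √(∫ x, f x ^ 2 ∂μ) * √(∫ x, g x ^ 2 ∂μ) := by
  have h2 : Real.HolderConjugate 2 2 := Real.HolderConjugate.two_two
  have h := integral_mul_le_Lp_mul_Lq_of_nonneg (μ := μ) h2 (f := fun x => |f x|)
    (g := fun x => |g x|) (Filter.Eventually.of_forall fun x => abs_nonneg _)
    (Filter.Eventually.of_forall fun x => abs_nonneg _)
    (by rw [ENNReal.ofReal_ofNat]; exact hf.abs) (by rw [ENNReal.ofReal_ofNat]; exact hg.abs)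
  rw [Real.sqrt_eq_rpow, Real.sqrt_eq_rpow]
  simp only [Real.rpow_two, sq_abs] at h
  refine (abs_integral_le_integral_abs).trans ?_
  simpa only [abs_mul] using h

theorem Continuous.memLp_two_restrict {f : E3 → ℝ} (hf : Continuous f) {s : Set E3}
    (hs : IsCompact s) : MemLp f 2 (volume.restrict s) := by
  rw [memLp_two_iff_integrable_sq hf.aestronglyMeasurable]
  exact ((hf.pow 2).continuousOn).integrableOn_compact hs

/-- The Cauchy-Schwarz inequality for an integral that is localized in a compact set. -/
theorem abs_integral_mul_le_of_eq_zero {f g : E3 → ℝ} (hf : Continuous f) (hg : Continuous g)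
    {s : Set E3} (hs : IsCompact s) (h0 : ∀ x ∉ s, f x * g x = 0) :
    |∫ x, f x * g x| ≤ √(∫ x in s, f x ^ 2) * √(∫ x in s, g x ^ 2) := by
  rw [← setIntegral_eq_integral_of_forall_compl_eq_zero h0]
  exact abs_integral_mul_le_sqrt_mul_sqrt (hf.memLp_two_restrict hs) (hg.memLp_two_restrict hs)

/-! ### Convolution. -/

/-- The convolution of two scalar functions on Euclidean space. -/
noncomputable def conv (k f : E3 → ℝ) (x : E3) : ℝ := ∫ y, k y * f (x - y)

section Convolution

variable {k f : E3 → ℝ}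

theorem conv_eq_convolution (k f : E3 → ℝ) :
    conv k f = convolution k f (ContinuousLinearMap.mul ℝ ℝ) volume := rfl

theorem HasCompactSupport.comp_sub_left (hfc : HasCompactSupport f) (x : E3) :
    HasCompactSupport fun y => f (x - y) :=
  hfc.comp_homeomorph (Homeomorph.subLeft x)

theorem integrable_mul_comp_sub (hk : Continuous k) (hf : Continuous f)
    (hfc : HasCompactSupport f) (x : E3) : Integrable fun y => k y * f (x - y) :=
  (hk.mul (hf.comp (by fun_prop : Continuous fun y : E3 => x - y))).integrable_of_hasCompactSupport
    (hfc.comp_sub_left x).mul_left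

theorem ContDiff.conv {n : ℕ∞} (hk : Continuous k) (hf : ContDiff ℝ n f)
    (hfc : HasCompactSupport f) : ContDiff ℝ n (conv k f) := by
  rw [conv_eq_convolution]
  exact hfc.contDiff_convolution_right _ hk.locallyIntegrable hf

theorem pd_conv (hk : Continuous k) (hf : ContDiff ℝ 1 f) (hfc : HasCompactSupport f)
    (j : Fin 3) : pd j (conv k f) = conv k (pd j f) := by
  funext x
  rw [conv_eq_convolution, pd,
    (hfc.hasFDerivAt_convolution_right _ hk.locallyIntegrable hf x).fderiv,
    convolution_precompR_apply _ hk.locallyIntegrable (hfc.fderiv ℝ)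
      (hf.continuous_fderiv one_ne_zero)]
  rfl

/-- Integration by parts in the convolution variable. It lets algebraic identities of the kernel,
such as symmetry of its Hessian, pass to potentials. -/
theorem conv_pd (hk : ContDiff ℝ 1 k) (hf : ContDiff ℝ 1 f) (hfc : HasCompactSupport f)
    (j : Fin 3) : conv k (pd j f) = conv (pd j k) f := by
  funext x
  have hG : ContDiff ℝ 1 fun y => f (x - y) := hf.comp (contDiff_const.sub contDiff_id)
  have hd : ∀ y, pd j (fun y => f (x - y)) y = - pd j f (x - y) := by
    intro y
    have h1 : HasFDerivAt (fun y : E3 => x - y) (-ContinuousLinearMap.id ℝ E3) y :=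
      (hasFDerivAt_id y).const_sub x
    have h2 := ((hf.differentiable one_ne_zero) (x - y)).hasFDerivAt.comp y h1
    have h3 : (f ∘ fun y => x - y) = fun y => f (x - y) := rfl
    rw [pd, ← h3, h2.fderiv]; simp [pd]
  have h := integral_mul_pd j (hk.differentiable (by norm_num)) (hk.continuous_pd j) hG
    (hfc.comp_sub_left x)
  simp only [hd, mul_neg, integral_neg, neg_inj] at h
  exact h

theorem conv_sum {ι : Type*} (s : Finset ι) {F : ι → E3 → ℝ} (hk : Continuous k)
    (hF : ∀ i ∈ s, Continuous (F i)) (hFc : ∀ i ∈ s, HasCompactSupport (F i)) (x : E3) :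
    conv k (fun y => ∑ i ∈ s, F i y) x = ∑ i ∈ s, conv k (F i) x := by
  simp only [conv, Finset.mul_sum]
  exact integral_finsetSum s fun i hi => integrable_mul_comp_sub hk (hF i hi) (hFc i hi) x

theorem sum_conv {ι : Type*} (s : Finset ι) {K : ι → E3 → ℝ} (hK : ∀ i ∈ s, Continuous (K i))
    (hf : Continuous f) (hfc : HasCompactSupport f) (x : E3) :
    conv (fun y => ∑ i ∈ s, K i y) f x = ∑ i ∈ s, conv (K i) f x := by
  simp only [conv, Finset.sum_mul]
  exact integral_finsetSum s fun i hi => integrable_mul_comp_sub (hK i hi) hf hfc x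

theorem conv_neg_left (k f : E3 → ℝ) (x : E3) : conv (fun y => - k y) f x = - conv k f x := by
  simp [conv, integral_neg]

/-- Convolution with a compactly supported function preserves decay of order two. -/
theorem abs_conv_le_of_decay {C : ℝ} (hk : Continuous k)
    (hkC : ∀ y, |k y| ≤ C * (1 + ‖y‖ ^ 2)⁻¹) (hf : Continuous f) (hfc : HasCompactSupport f) :
    ∃ C', ∀ x, |conv k f x| ≤ C' * (1 + ‖x‖ ^ 2)⁻¹ := by
  obtain ⟨ρ, hρ⟩ := hfc.isCompact.isBounded.exists_norm_le
  have hC : 0 ≤ C := by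
    have := (abs_nonneg _).trans (hkC 0); simpa using this
  refine ⟨C * (2 * (1 + ρ ^ 2)) * ∫ y, |f y|, fun x => ?_⟩
  have hfi : Integrable fun y => |f (x - y)| :=
    ((hf.integrable_of_hasCompactSupport hfc).abs).comp_sub_left x
  calc |conv k f x| ≤ ∫ y, |k y * f (x - y)| := abs_integral_le_integral_abs
    _ ≤ ∫ y, C * (2 * (1 + ρ ^ 2)) * (1 + ‖x‖ ^ 2)⁻¹ * |f (x - y)| := by
        refine integral_mono (integrable_mul_comp_sub hk hf hfc x).abs (hfi.const_mul _) fun y => ?_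
        simp only [abs_mul]
        by_cases h0 : f (x - y) = 0
        · simp [h0]
        refine mul_le_mul_of_nonneg_right ((hkC y).trans ?_) (abs_nonneg _)
        have hxy : ‖x - y‖ ≤ ρ := hρ _ (subset_tsupport f h0)
        have hx : ‖x‖ ≤ ‖y‖ + ρ := by
          have := norm_add_le y (x - y); rw [add_sub_cancel] at this; linarith
        -- Only y within ρ of x contribute, so the weights at x and y are comparable.
        have h1 : 1 + ‖x‖ ^ 2 ≤ 2 * (1 + ρ ^ 2) * (1 + ‖y‖ ^ 2) := by
          have := norm_nonneg x
          have h2 : ‖x‖ ^ 2 ≤ (‖y‖ + ρ) ^ 2 := by gcongr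
          nlinarith [sq_nonneg (‖y‖ - ρ), sq_nonneg (‖y‖ * ρ)]
        rw [mul_assoc]
        refine mul_le_mul_of_nonneg_left ?_ hC
        rw [← div_eq_mul_inv, le_div_iff₀ (by positivity), inv_mul_le_iff₀ (by positivity)]
        linarith
    _ = _ := by
        rw [integral_const_mul, integral_sub_left_eq_self (fun y => |f y|)]; ring

/-- Young's inequality for the convolution with an integrable function in `L²`. -/
theorem integral_conv_sq_le (hk : Continuous k) (hk0 : ∀ y, 0 ≤ k y) (hki : Integrable k)
    (hf : Continuous f) (hfc : HasCompactSupport f) :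
    ∫ x, conv k f x ^ 2 ≤ (∫ y, k y) ^ 2 * ∫ x, f x ^ 2 := by
  have hf2 : Continuous fun x => f x ^ 2 := hf.pow 2
  have hf2c : HasCompactSupport fun x => f x ^ 2 := by
    simp only [sq]; exact hfc.mul_left
  have hf2i := hf2.integrable_of_hasCompactSupport (μ := volume) hf2c
  have hint : Integrable (conv k fun x => f x ^ 2) := by
    rw [conv_eq_convolution]; exact hki.integrable_convolution _ hf2i
  have hpt : ∀ x, conv k f x ^ 2 ≤ (∫ y, k y) * conv k (fun x => f x ^ 2) x := by
    intro x
    -- Splitting k = √k · √k turns Cauchy-Schwarz into a pointwise Jensen-type bound, which is then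
    -- integrated using that the integral of a convolution is the product of the integrals.
    have hsq : ∀ y, √(k y) ^ 2 = k y := fun y => Real.sq_sqrt (hk0 y)
    have hkk := integrable_mul_comp_sub hk hf2 hf2c x
    have hs1 : MemLp (fun y => √(k y)) 2 volume := by
      rw [memLp_two_iff_integrable_sq hk.sqrt.aestronglyMeasurable]
      simpa only [hsq] using hki
    have hs2 : MemLp (fun y => √(k y) * f (x - y)) 2 volume := by
      have hc : Continuous fun y => √(k y) * f (x - y) := by fun_prop
      rw [memLp_two_iff_integrable_sq hc.aestronglyMeasurable]
      simpa only [mul_pow, hsq] using hkk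
    have h := abs_integral_mul_le_sqrt_mul_sqrt hs1 hs2
    have he : ∀ y, √(k y) * (√(k y) * f (x - y)) = k y * f (x - y) := by
      intro y; rw [← mul_assoc, Real.mul_self_sqrt (hk0 y)]
    simp only [he, mul_pow, hsq] at h
    have h2 := pow_le_pow_left₀ (abs_nonneg _) h 2
    rwa [sq_abs, mul_pow, Real.sq_sqrt (integral_nonneg hk0),
      Real.sq_sqrt (integral_nonneg fun y => mul_nonneg (hk0 y) (sq_nonneg _))] at h2
  calc ∫ x, conv k f x ^ 2 ≤ ∫ x, (∫ y, k y) * conv k (fun x => f x ^ 2) x :=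
        integral_mono_of_nonneg (Filter.Eventually.of_forall fun x => sq_nonneg _)
          (hint.const_mul _) (Filter.Eventually.of_forall hpt)
    _ = _ := by
        rw [integral_const_mul, conv_eq_convolution, integral_convolution _ hki hf2i]
        simp; ring

end Convolution

/-! ### The regularized Newtonian kernel and its mollifier. -/

theorem pd_comp {f : E3 → ℝ} {φ : ℝ → ℝ} {d : ℝ} {x : E3} (j : Fin 3) (hφ : HasDerivAt φ d (f x))
    (hf : DifferentiableAt ℝ f x) : pd j (fun y => φ (f y)) x = d * pd j f x := by
  have h := hφ.comp_hasFDerivAt x hf.hasFDerivAt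
  have h3 : (φ ∘ f) = fun y => φ (f y) := rfl
  rw [pd, ← h3, h.fderiv]; simp [pd]

theorem hasFDerivAt_coord (i : Fin 3) (x : E3) :
    HasFDerivAt (fun y : E3 => y i) (EuclideanSpace.proj (𝕜 := ℝ) i) x :=
  (EuclideanSpace.proj (𝕜 := ℝ) i : E3 →L[ℝ] ℝ).hasFDerivAt

theorem contDiff_coord {n : WithTop ℕ∞} (i : Fin 3) : ContDiff ℝ n fun y : E3 => y i :=
  (EuclideanSpace.proj (𝕜 := ℝ) i : E3 →L[ℝ] ℝ).contDiff

theorem pd_coord (i j : Fin 3) (x : E3) : pd j (fun y => y i) x = if i = j then 1 else 0 := by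
  rw [pd, (hasFDerivAt_coord i x).fderiv]; simp

theorem pd_norm_sq_add (c : ℝ) (j : Fin 3) (x : E3) :
    pd j (fun y => ‖y‖ ^ 2 + c) x = 2 * x j := by
  have h := ((hasStrictFDerivAt_norm_sq x).hasFDerivAt).add_const c
  rw [pd, h.fderiv]
  simp [EuclideanSpace.inner_single_right]

theorem contDiff_norm_sq_add {n : WithTop ℕ∞} (c : ℝ) :
    ContDiff ℝ n fun y : E3 => ‖y‖ ^ 2 + c := (contDiff_norm_sq ℝ).add contDiff_const

theorem norm_sq_eq_sum (x : E3) : ‖x‖ ^ 2 = ∑ i, x i ^ 2 := EuclideanSpace.real_norm_sq_eq x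

theorem abs_coord_le (x : E3) (i : Fin 3) : |x i| ≤ ‖x‖ := by
  have := PiLp.norm_apply_le x i; simpa using this

/-- The `i`-th partial derivative of the regularized Newtonian kernel `(‖y‖² + ε²)^(-1/2)`. -/
noncomputable def potKer (ε : ℝ) (i : Fin 3) (y : E3) : ℝ :=
  -(y i * (‖y‖ ^ 2 + ε ^ 2) ^ (-(3 / 2) : ℝ))

/-- Minus the Laplacian of the regularized Newtonian kernel `(‖y‖² + ε²)^(-1/2)`. -/
noncomputable def mol (ε : ℝ) (y : E3) : ℝ :=
  3 * ε ^ 2 * (‖y‖ ^ 2 + ε ^ 2) ^ (-(5 / 2) : ℝ)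

section Kernel

variable {ε : ℝ}

theorem norm_sq_add_pos (hε : 0 < ε) (y : E3) : 0 < ‖y‖ ^ 2 + ε ^ 2 := by positivity

theorem contDiff_potKer {n : WithTop ℕ∞} (hε : 0 < ε) (i : Fin 3) : ContDiff ℝ n (potKer ε i) :=
  ((contDiff_coord i).mul ((contDiff_norm_sq_add _).rpow_const_of_ne
    fun y => (norm_sq_add_pos hε y).ne')).neg

theorem continuous_mol (hε : 0 < ε) : Continuous (mol ε) :=
  continuous_const.mul (((contDiff_norm_sq_add (n := 0) _).rpow_const_of_ne
    fun y => (norm_sq_add_pos hε y).ne').continuous)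

theorem mol_nonneg (y : E3) : 0 ≤ mol ε y := by unfold mol; positivity

theorem pd_potKer (hε : 0 < ε) (i j : Fin 3) (y : E3) :
    pd j (potKer ε i) y = -((if i = j then 1 else 0) * (‖y‖ ^ 2 + ε ^ 2) ^ (-(3 / 2) : ℝ))
      + 3 * (y i * y j) * (‖y‖ ^ 2 + ε ^ 2) ^ (-(5 / 2) : ℝ) := by
  have hp := norm_sq_add_pos hε y
  have hd : DifferentiableAt ℝ (fun y : E3 => ‖y‖ ^ 2 + ε ^ 2) y :=
    (contDiff_norm_sq_add (n := 1) _).differentiable one_ne_zero y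
  have h1 := pd_comp j (Real.hasDerivAt_rpow_const (p := -(3 / 2)) (Or.inl hp.ne')) hd
  have hd2 : DifferentiableAt ℝ (fun y : E3 => (‖y‖ ^ 2 + ε ^ 2) ^ (-(3 / 2) : ℝ)) y :=
    hd.rpow_const (Or.inl hp.ne')
  unfold potKer
  rw [pd_neg, pd_mul j (hasFDerivAt_coord i y).differentiableAt hd2, pd_coord, h1, pd_norm_sq_add]
  rw [show (-(3 / 2) - 1 : ℝ) = -(5 / 2) by norm_num]
  ring

/-- Both sides are the same second derivative of the regularized kernel. -/
theorem pd_potKer_comm (hε : 0 < ε) (i j : Fin 3) :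
    pd j (potKer ε i) = pd i (potKer ε j) := by
  funext y
  rw [pd_potKer hε, pd_potKer hε]
  simp only [eq_comm (a := i) (b := j)]; ring

/-- With r = ‖y‖² + ε², the trace is (-3r + 3‖y‖²) r^(-5/2), and the numerator collapses to -3ε². -/
theorem sum_pd_potKer (hε : 0 < ε) (y : E3) : ∑ j, pd j (potKer ε j) y = - mol ε y := by
  have hp := norm_sq_add_pos hε y
  have h : (‖y‖ ^ 2 + ε ^ 2) ^ (-(3 / 2) : ℝ)
      = (‖y‖ ^ 2 + ε ^ 2) * (‖y‖ ^ 2 + ε ^ 2) ^ (-(5 / 2) : ℝ) := by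
    nth_rewrite 2 [← Real.rpow_one (‖y‖ ^ 2 + ε ^ 2)]
    rw [← Real.rpow_add hp]; norm_num
  simp only [pd_potKer hε, Fin.sum_univ_three, if_true, h, mol]
  have hs := norm_sq_eq_sum y
  simp only [Fin.sum_univ_three] at hs
  generalize (‖y‖ ^ 2 + ε ^ 2) ^ (-(5 / 2) : ℝ) = r
  rw [hs]; ring

/-- The constant blows up as ε tends to 0. This is harmless: the bound only serves to justify
integrations by parts at fixed ε. -/
theorem abs_potKer_le (hε : 0 < ε) (hε1 : ε ≤ 1) (i : Fin 3) (y : E3) :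
    |potKer ε i y| ≤ (ε ^ 2)⁻¹ * (1 + ‖y‖ ^ 2)⁻¹ := by
  have hp := norm_sq_add_pos hε y
  set a := ‖y‖ ^ 2 + ε ^ 2 with ha
  have h1 : |y i| ≤ a ^ (1 / 2 : ℝ) := by
    rw [← Real.sqrt_eq_rpow]
    exact (abs_coord_le y i).trans (Real.le_sqrt_of_sq_le (by rw [ha]; nlinarith))
  have h2 : |potKer ε i y| ≤ a⁻¹ := by
    rw [potKer, abs_neg, abs_mul, abs_of_pos (Real.rpow_pos_of_pos hp _)]
    calc |y i| * a ^ (-(3 / 2) : ℝ) ≤ a ^ (1 / 2 : ℝ) * a ^ (-(3 / 2) : ℝ) := by gcongr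
      _ = a⁻¹ := by rw [← Real.rpow_add hp, ← Real.rpow_neg_one]; norm_num
  refine h2.trans ?_
  rw [← mul_inv]
  refine inv_anti₀ (by positivity) ?_
  have : ε ^ 2 ≤ 1 := pow_le_one₀ hε.le hε1
  rw [ha]; nlinarith [sq_nonneg ‖y‖]

theorem integrable_mol_one : Integrable (mol 1) := by
  have h := integrable_rpow_neg_one_add_norm_sq (E := E3) (μ := volume) (r := 5)
    (by rw [finrank_euclideanSpace_fin]; norm_num)
  have : mol 1 = fun y => 3 * ((1 : ℝ) + ‖y‖ ^ 2) ^ (-5 / 2 : ℝ) := by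
    funext y; unfold mol; rw [add_comm]; norm_num
  rw [this]; exact h.const_mul 3

/-- The L¹ scaling in dimension three, which makes the mass independent of ε and the family an
approximate identity. -/
theorem mol_smul (hε : 0 < ε) (z : E3) : mol ε (ε • z) = (ε ^ 3)⁻¹ * mol 1 z := by
  have h5 : (ε ^ 2) ^ (-(5 / 2) : ℝ) = (ε ^ 5)⁻¹ := by
    rw [← Real.rpow_natCast, ← Real.rpow_mul hε.le, ← Real.rpow_natCast, ← Real.rpow_neg hε.le]
    norm_num
  unfold mol
  rw [norm_smul, Real.norm_of_nonneg hε.le,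
    show (ε * ‖z‖) ^ 2 + ε ^ 2 = ε ^ 2 * (‖z‖ ^ 2 + 1 ^ 2) by ring,
    Real.mul_rpow (by positivity) (by positivity), h5]
  field_simp

theorem integral_mol_mul (hε : 0 < ε) (g : E3 → ℝ) :
    ∫ y, mol ε y * g y = ∫ z, mol 1 z * g (ε • z) := by
  have h := Measure.integral_comp_smul volume (fun y => mol ε y * g y) ε
  simp only [mol_smul hε, mul_assoc, integral_const_mul, finrank_euclideanSpace_fin,
    smul_eq_mul] at h
  rw [abs_of_pos (by positivity)] at h
  exact (mul_left_cancel₀ (by positivity) h).symm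

theorem integral_mol (hε : 0 < ε) : ∫ y, mol ε y = ∫ z, mol 1 z := by
  simpa using integral_mol_mul hε fun _ => 1

theorem integrable_mol (hε : 0 < ε) : Integrable (mol ε) := by
  rw [← integrable_comp_smul_iff volume (mol ε) hε.ne']
  simp only [mol_smul hε]
  exact integrable_mol_one.const_mul _

/-- The value of the mass is irrelevant: it appears on both sides of the pressure estimate and is
cancelled, for which positivity suffices. -/
theorem integral_mol_one_pos : 0 < ∫ z, mol 1 z := by
  rw [integral_pos_iff_support_of_nonneg mol_nonneg integrable_mol_one]
  have : Function.support (mol 1) = Set.univ := by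
    ext y; simp only [Function.mem_support, Set.mem_univ, iff_true]; unfold mol; positivity
  rw [this]; simp

theorem conv_mol (hε : 0 < ε) (g : E3 → ℝ) (x : E3) :
    conv (mol ε) g x = ∫ z, mol 1 z * g (x - ε • z) :=
  integral_mol_mul hε fun y => g (x - y)

theorem abs_conv_mol_le (hε : 0 < ε) {g : E3 → ℝ} {M : ℝ} (hM : ∀ x, |g x| ≤ M) (x : E3) :
    |conv (mol ε) g x| ≤ (∫ z, mol 1 z) * M := by
  rw [← integral_mol hε, ← integral_mul_const]
  refine abs_integral_le_integral_abs.trans (integral_mono_of_nonneg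
    (Filter.Eventually.of_forall fun y => abs_nonneg _) ((integrable_mol hε).mul_const M)
    (Filter.Eventually.of_forall fun y => ?_))
  simp only [abs_mul, abs_of_nonneg (mol_nonneg (ε := ε) y)]
  exact mul_le_mul_of_nonneg_left (hM _) (mol_nonneg y)

/-- The mollifiers `mol ε` form an approximate identity up to a constant factor. -/
theorem tendsto_conv_mol {g : E3 → ℝ} (hg : Continuous g) {M : ℝ} (hM : ∀ x, |g x| ≤ M) {e : ℕ → ℝ}
    (he : ∀ n, 0 < e n) (he0 : Filter.Tendsto e Filter.atTop (nhds 0)) (x : E3) :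
    Filter.Tendsto (fun n => conv (mol (e n)) g x) Filter.atTop (nhds ((∫ z, mol 1 z) * g x)) := by
  simp only [conv_mol (he _)]
  rw [← integral_mul_const]
  refine tendsto_integral_of_dominated_convergence (fun z => mol 1 z * M) (fun n => ?_)
    (integrable_mol_one.mul_const M) (fun n => Filter.Eventually.of_forall fun z => ?_)
    (Filter.Eventually.of_forall fun z => ?_)
  · have := continuous_mol one_pos
    exact (by fun_prop : Continuous fun z => mol 1 z * g (x - e n • z)).aestronglyMeasurable
  · rw [Real.norm_eq_abs, abs_mul, abs_of_nonneg (mol_nonneg z)]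
    exact mul_le_mul_of_nonneg_left (hM _) (mol_nonneg z)
  · refine Filter.Tendsto.const_mul _ ?_
    have h1 : Filter.Tendsto (fun n => x - e n • z) Filter.atTop (nhds (x - (0 : ℝ) • z)) :=
      tendsto_const_nhds.sub (he0.smul_const z)
    rw [zero_smul, sub_zero] at h1
    exact (hg.tendsto x).comp h1

end Kernel

/-! ### Decay at infinity and Hardy's inequality. -/

/-- Decay of order two at infinity. -/
def Decays (v : E3 → ℝ) : Prop := ∃ C, ∀ x, |v x| ≤ C * (1 + ‖x‖ ^ 2)⁻¹

/-- The product decays to order four, which exceeds the dimension three. -/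
theorem Decays.integrable_mul {u v : E3 → ℝ} (hu : Decays u) (hv : Decays v)
    (huc : Continuous u) (hvc : Continuous v) : Integrable fun x => u x * v x := by
  obtain ⟨C, hC⟩ := hu
  obtain ⟨D, hD⟩ := hv
  have h := integrable_rpow_neg_one_add_norm_sq (E := E3) (μ := volume) (r := 4)
    (by rw [finrank_euclideanSpace_fin]; norm_num)
  refine (h.const_mul (C * D)).mono' (huc.mul hvc).aestronglyMeasurable
    (Filter.Eventually.of_forall fun x => ?_)
  have hC0 : 0 ≤ C * (1 + ‖x‖ ^ 2)⁻¹ := (abs_nonneg _).trans (hC x)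
  have h2 : ((1 : ℝ) + ‖x‖ ^ 2) ^ (-4 / 2 : ℝ) = (1 + ‖x‖ ^ 2)⁻¹ * (1 + ‖x‖ ^ 2)⁻¹ := by
    rw [show (-4 / 2 : ℝ) = -(2 : ℕ) by norm_num, Real.rpow_neg (by positivity),
      Real.rpow_natCast, sq, mul_inv]
  rw [Real.norm_eq_abs, abs_mul, h2]
  calc |u x| * |v x| ≤ (C * (1 + ‖x‖ ^ 2)⁻¹) * (D * (1 + ‖x‖ ^ 2)⁻¹) :=
        mul_le_mul (hC x) (hD x) (abs_nonneg _) hC0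
    _ = _ := by ring

theorem Decays.bdd_mul {a v : E3 → ℝ} (hv : Decays v) {M : ℝ} (ha : ∀ x, |a x| ≤ M) :
    Decays fun x => a x * v x := by
  obtain ⟨C, hC⟩ := hv
  refine ⟨M * C, fun x => ?_⟩
  rw [abs_mul, mul_assoc]
  exact mul_le_mul (ha x) (hC x) (abs_nonneg _) ((abs_nonneg _).trans (ha x))

/-- A regularized Hardy inequality. -/
theorem integral_inv_mul_sq_le {v : E3 → ℝ} (hv : ContDiff ℝ 1 v) (hd : Decays v)
    (hd' : ∀ j, Decays (pd j v)) {R : ℝ} (hR : 0 < R) :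
    ∫ x, (‖x‖ ^ 2 + R ^ 2)⁻¹ * v x ^ 2 ≤ 4 * ∑ j, ∫ x, pd j v x ^ 2 := by
  set W : E3 → ℝ := fun x => (‖x‖ ^ 2 + R ^ 2)⁻¹ with hW
  have hpos : ∀ x : E3, 0 < ‖x‖ ^ 2 + R ^ 2 := fun x => by positivity
  have hW0 : ∀ x, 0 < W x := fun x => inv_pos.2 (hpos x)
  have hWc : ContDiff ℝ 1 W := (contDiff_norm_sq_add _).inv fun x => (hpos x).ne'
  have hWx : ∀ x, ‖x‖ ^ 2 * W x ≤ 1 := fun x => by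
    rw [hW, ← div_eq_mul_inv, div_le_one (hpos x)]; nlinarith
  have hWR' : ∀ x, |W x| ≤ (R ^ 2)⁻¹ := fun x => by
    rw [abs_of_pos (hW0 x), ← div_one (R ^ 2)⁻¹, le_div_iff₀ one_pos, mul_one,
      le_inv_comm₀ (hW0 x) (by positivity), le_inv_comm₀ (by positivity) (hW0 x)]
    exact inv_anti₀ (by positivity) (by nlinarith [sq_nonneg ‖x‖])
  have hcoord : ∀ (x : E3) j, x j ^ 2 ≤ ‖x‖ ^ 2 := fun x j => by
    rw [← sq_abs (x j)]; exact pow_le_pow_left₀ (abs_nonneg _) (abs_coord_le x j) 2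
  have ha : ∀ j, ContDiff ℝ 1 fun x : E3 => x j * W x := fun j => (contDiff_coord j).mul hWc
  -- The inequality comes from the vector field xW: its divergence is 3W - 2‖x‖²W², which is at
  -- least W because ‖x‖²W ≤ 1.
  have hpa : ∀ j x, pd j (fun x : E3 => x j * W x) x = W x - 2 * x j ^ 2 * W x ^ 2 := by
    intro j x
    have h1 : pd j W x = -((‖x‖ ^ 2 + R ^ 2) ^ 2)⁻¹ * (2 * x j) := by
      rw [← pd_norm_sq_add (R ^ 2)]
      exact pd_comp j (hasDerivAt_inv (hpos x).ne')
        ((contDiff_norm_sq_add (n := 1) _).differentiable one_ne_zero x)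
    rw [pd_mul j (hasFDerivAt_coord j x).differentiableAt (hWc.differentiable one_ne_zero x), h1,
      pd_coord, if_pos rfl, ← inv_pow]
    ring
  have hab : ∀ j x, |x j * W x| ≤ R⁻¹ := by
    intro j x
    rw [abs_mul, abs_of_pos (hW0 x), hW, ← div_eq_mul_inv, div_le_iff₀ (hpos x),
      inv_mul_eq_div, le_div_iff₀ hR]
    nlinarith [abs_coord_le x j, sq_nonneg (‖x‖ - R), abs_nonneg (x j), norm_nonneg x]
  have hpab : ∀ j x, |W x - 2 * x j ^ 2 * W x ^ 2| ≤ 3 * (R ^ 2)⁻¹ := by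
    intro j x
    have h1 : x j ^ 2 * W x ≤ 1 :=
      (mul_le_mul_of_nonneg_right (hcoord x j) (hW0 x).le).trans (hWx x)
    have h2 := hWR' x
    rw [abs_of_pos (hW0 x)] at h2
    have h3 : x j ^ 2 * W x ^ 2 ≤ W x := by
      nlinarith [mul_le_mul_of_nonneg_right h1 (hW0 x).le]
    have h4 : 0 ≤ x j ^ 2 * W x ^ 2 := by positivity
    rw [abs_le]; constructor <;> nlinarith [hW0 x]
  have hvc := hv.continuous
  have hvd := hv.differentiable one_ne_zero
  have hsq : ContDiff ℝ 1 fun x => v x * v x := hv.mul hv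
  have hpsq : ∀ j x, pd j (fun x => v x * v x) x = 2 * (v x * pd j v x) := fun j x => by
    rw [pd_mul j (hvd x) (hvd x)]; ring
  have hiv : ∀ j, Integrable fun x => (W x - 2 * x j ^ 2 * W x ^ 2) * (v x * v x) := by
    intro j
    have := (hd.bdd_mul (hpab j)).integrable_mul hd
      (by have := hWc.continuous; have := (contDiff_coord (n := 1) j).continuous; fun_prop) hvc
    simpa only [mul_assoc] using this
  have hi1 : ∀ j, Integrable fun x => x j * W x * (v x * pd j v x) := by
    intro j
    have := (hd.bdd_mul (hab j)).integrable_mul (hd' j)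
      ((ha j).continuous.mul hvc) (hv.continuous_pd j)
    simpa only [mul_assoc] using this
  have hi2 : ∀ j, Integrable fun x => x j * W x * (v x * v x) := by
    intro j
    have := (hd.bdd_mul (hab j)).integrable_mul hd ((ha j).continuous.mul hvc) hvc
    simpa only [mul_assoc] using this
  have hiW : Integrable fun x => W x * v x ^ 2 := by
    have := (hd.bdd_mul hWR').integrable_mul hd (hWc.continuous.mul hvc) hvc
    simpa only [mul_assoc, sq] using this
  have hip : ∀ j, Integrable fun x => pd j v x ^ 2 := by
    intro j
    have := (hd' j).integrable_mul (hd' j) (hv.continuous_pd j) (hv.continuous_pd j)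
    simpa only [sq] using this
  have hibp : ∀ j, ∫ x, (W x - 2 * x j ^ 2 * W x ^ 2) * (v x * v x)
      = - ∫ x, 2 * (x j * W x * (v x * pd j v x)) := by
    intro j
    have h := integral_mul_pd_of_integrable j ((ha j).differentiable one_ne_zero)
      (hsq.differentiable one_ne_zero)
      (by simp only [hpa]; exact hiv j)
      (by simp only [hpsq]; exact ((hi1 j).const_mul 2).congr
            (Filter.Eventually.of_forall fun x => by ring)) (hi2 j)
    simp only [hpa, hpsq] at h
    rw [eq_neg_iff_add_eq_zero, add_comm, ← eq_neg_iff_add_eq_zero, ← h]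
    exact integral_congr_ae (Filter.Eventually.of_forall fun x => by ring)
  have hni : ∀ j, Integrable fun x => -(2 * (x j * W x * (v x * pd j v x))) :=
    fun j => ((hi1 j).const_mul 2).neg
  have hmain : ∫ x, W x * v x ^ 2
      ≤ ∫ x, ((1 / 2) * (W x * v x ^ 2) + 2 * ∑ j, pd j v x ^ 2) := by
    calc ∫ x, W x * v x ^ 2
        ≤ ∫ x, ∑ j : Fin 3, (W x - 2 * x j ^ 2 * W x ^ 2) * (v x * v x) := by
          refine integral_mono hiW (integrable_finsetSum _ fun j _ => hiv j) fun x => ?_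
          simp only [Fin.sum_univ_three]
          have hs := norm_sq_eq_sum x
          simp only [Fin.sum_univ_three] at hs
          have h1 := hWx x
          have h2 := mul_le_mul_of_nonneg_right h1 (hW0 x).le
          have h3 := mul_le_mul_of_nonneg_right h2 (sq_nonneg (v x))
          rw [hs] at h3
          nlinarith
      _ = ∫ x, ∑ j : Fin 3, -(2 * (x j * W x * (v x * pd j v x))) := by
          rw [integral_finsetSum _ fun j _ => hiv j, integral_finsetSum _ fun j _ => hni j]
          simp only [hibp, integral_neg]
      _ ≤ _ := by
          refine integral_mono (integrable_finsetSum _ fun j _ => hni j)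
            ((hiW.const_mul _).add ((integrable_finsetSum _ fun j _ => hip j).const_mul _))
            fun x => ?_
          simp only [Fin.sum_univ_three]
          have hs := norm_sq_eq_sum x
          simp only [Fin.sum_univ_three] at hs
          have h1 := hWx x
          have h2 := mul_le_mul_of_nonneg_right h1 (hW0 x).le
          have h3 := mul_le_mul_of_nonneg_right h2 (sq_nonneg (v x))
          rw [hs] at h3
          -- Young's inequality -2ab ≤ a²/2 + 2b² with a = x_j W v and b = ∂_j v; the squares a² sum
          -- to at most W v², so half of the left side is absorbed later.
          nlinarith [sq_nonneg (x 0 * W x * v x + 2 * pd 0 v x),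
            sq_nonneg (x 1 * W x * v x + 2 * pd 1 v x), sq_nonneg (x 2 * W x * v x + 2 * pd 2 v x)]
  rw [integral_add (hiW.const_mul _) ((integrable_finsetSum _ fun j _ => hip j).const_mul _),
    integral_const_mul, integral_const_mul, integral_finsetSum _ fun j _ => hip j] at hmain
  linarith

/-! ### L² theory of the regularized potential. -/

/-- The `i`-th component of the gradient of the regularized Newtonian potential of `h`. -/
noncomputable def pot (ε : ℝ) (i : Fin 3) (h : E3 → ℝ) : E3 → ℝ := conv (potKer ε i) h

section Potential

variable {ε : ℝ} {h : E3 → ℝ}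

theorem contDiff_pot {n : ℕ∞} (hε : 0 < ε) (i : Fin 3) (hh : ContDiff ℝ n h)
    (hc : HasCompactSupport h) : ContDiff ℝ n (pot ε i h) :=
  ContDiff.conv (contDiff_potKer (n := 0) hε i).continuous hh hc

theorem pd_pot (hε : 0 < ε) (i j : Fin 3) (hh : ContDiff ℝ 1 h) (hc : HasCompactSupport h) :
    pd j (pot ε i h) = pot ε i (pd j h) :=
  pd_conv (contDiff_potKer (n := 0) hε i).continuous hh hc j

theorem pd_pot_comm (hε : 0 < ε) (i j : Fin 3) (hh : ContDiff ℝ 1 h) (hc : HasCompactSupport h) :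
    pd j (pot ε i h) = pd i (pot ε j h) := by
  rw [pd_pot hε i j hh hc, pd_pot hε j i hh hc, pot, pot, conv_pd (contDiff_potKer hε i) hh hc,
    conv_pd (contDiff_potKer hε j) hh hc, pd_potKer_comm hε]

/-- The Laplacian of the potential returns minus the mollified datum, the regularized form of the
Poisson equation. -/
theorem sum_pd_pot (hε : 0 < ε) (hh : ContDiff ℝ 1 h) (hc : HasCompactSupport h) (x : E3) :
    ∑ j, pd j (pot ε j h) x = - conv (mol ε) h x := by
  have h1 : ∀ j, pd j (pot ε j h) x = conv (pd j (potKer ε j)) h x := fun j => by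
    rw [pd_pot hε j j hh hc, pot, conv_pd (contDiff_potKer hε j) hh hc]
  simp only [h1]
  rw [← sum_conv _ (fun j _ => (contDiff_potKer hε j).continuous_pd j) hh.continuous hc,
    ← conv_neg_left]
  simp only [sum_pd_potKer hε]

theorem decays_pot (hε : 0 < ε) (hε1 : ε ≤ 1) (i : Fin 3) (hh : Continuous h)
    (hc : HasCompactSupport h) : Decays (pot ε i h) :=
  abs_conv_le_of_decay (contDiff_potKer (n := 0) hε i).continuous (abs_potKer_le hε hε1 i) hh hc

variable (hε : 0 < ε) (hε1 : ε ≤ 1) (hh : ContDiff ℝ 2 h) (hc : HasCompactSupport h)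
include hε hε1 hh hc

/-- The derivative is put on the compactly supported datum instead of the kernel, so the same
order-two decay serves for all derivatives. -/
theorem decays_pd_pot (i j : Fin 3) : Decays (pd j (pot ε i h)) := by
  rw [pd_pot hε i j (hh.of_le (by norm_num)) hc]
  exact decays_pot hε hε1 i ((hh.of_le (by norm_num)).continuous_pd j) (hc.pd j)

theorem decays_pd_pd_pot (i j k : Fin 3) : Decays (pd k (pd j (pot ε i h))) := by
  rw [pd_pot hε i j (hh.of_le (by norm_num)) hc, pd_pot hε i k (hh.pd_one j) (hc.pd j)]
  exact decays_pot hε hε1 i ((hh.pd_one j).continuous_pd k) ((hc.pd j).pd k)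

/-- The gradient of the potential is curl free, so one factor may have its indices exchanged; two
integrations by parts then swap the derivatives between the factors. Summed over indices, this
identifies the L² norm of the Hessian with that of the Laplacian. -/
theorem integral_pd_pot_sq (i j : Fin 3) :
    ∫ x, pd j (pot ε i h) x ^ 2 = ∫ x, pd i (pot ε i h) x * pd j (pot ε j h) x := by
  have hC : ∀ i, ContDiff ℝ 2 (pot ε i h) := fun i => contDiff_pot (n := 2) hε i hh hc
  have hC1 : ∀ i, ContDiff ℝ 1 (pot ε i h) := fun i => (hC i).of_le (by norm_num)
  have key : ∀ a b : Fin 3, ∫ x, pd a (pot ε i h) x * pd b (pot ε j h) x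
      = - ∫ x, pot ε i h x * pd a (pd b (pot ε j h)) x := by
    intro a b
    rw [integral_mul_pd_of_integrable a ((hC1 i).differentiable one_ne_zero)
      (((hC j).pd_one b).differentiable one_ne_zero), neg_neg]
    · exact (decays_pd_pot hε hε1 hh hc i a).integrable_mul (decays_pd_pot hε hε1 hh hc j b)
        ((hC1 i).continuous_pd a) ((hC1 j).continuous_pd b)
    · exact (decays_pot hε hε1 i hh.continuous hc).integrable_mul
        (decays_pd_pd_pot hε hε1 hh hc j b a) (hC1 i).continuous (((hC j).pd_one b).continuous_pd a)
    · exact (decays_pot hε hε1 i hh.continuous hc).integrable_mul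
        (decays_pd_pot hε hε1 hh hc j b) (hC1 i).continuous ((hC1 j).continuous_pd b)
  have h1 : ∀ x, pd j (pot ε i h) x ^ 2 = pd j (pot ε i h) x * pd i (pot ε j h) x := fun x => by
    rw [sq, ← pd_pot_comm hε i j (hh.of_le (by norm_num)) hc]
  simp only [h1]
  rw [key, key]
  simp only [pd_comm i (hC j) j]

/-- The Hessian of the Newtonian potential is bounded in `L²` by its Laplacian. -/
theorem sum_integral_pd_pot_sq_le :
    ∑ i, ∑ j, ∫ x, pd j (pot ε i h) x ^ 2 ≤ (∫ z, mol 1 z) ^ 2 * ∫ x, h x ^ 2 := by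
  have hh1 : ContDiff ℝ 1 h := hh.of_le (by norm_num)
  have hC1 : ∀ i, ContDiff ℝ 1 (pot ε i h) := fun i => contDiff_pot (n := 1) hε i hh1 hc
  have hi : ∀ i j, Integrable fun x => pd i (pot ε i h) x * pd j (pot ε j h) x := fun i j =>
    (decays_pd_pot hε hε1 hh hc i i).integrable_mul (decays_pd_pot hε hε1 hh hc j j)
      ((hC1 i).continuous_pd i) ((hC1 j).continuous_pd j)
  calc ∑ i, ∑ j, ∫ x, pd j (pot ε i h) x ^ 2
      = ∫ x, ∑ i, ∑ j, pd i (pot ε i h) x * pd j (pot ε j h) x := by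
        simp only [integral_pd_pot_sq hε hε1 hh hc]
        rw [integral_finsetSum _ fun i _ => integrable_finsetSum _ fun j _ => hi i j]
        refine Finset.sum_congr rfl fun i _ => ?_
        rw [integral_finsetSum _ fun j _ => hi i j]
    _ = ∫ x, conv (mol ε) h x ^ 2 := by
        refine integral_congr_ae (Filter.Eventually.of_forall fun x => ?_)
        simp only [← Finset.mul_sum, ← Finset.sum_mul, sum_pd_pot hε hh1 hc]
        ring
    _ ≤ _ := by
        rw [← integral_mol hε]
        exact integral_conv_sq_le (continuous_mol hε) mol_nonneg (integrable_mol hε)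
          hh.continuous hc

theorem integral_pd_pot_sq_le (i j : Fin 3) :
    ∫ x, pd j (pot ε i h) x ^ 2 ≤ (∫ z, mol 1 z) ^ 2 * ∫ x, h x ^ 2 := by
  refine le_trans ?_ (sum_integral_pd_pot_sq_le hε hε1 hh hc)
  have hn : ∀ i j, 0 ≤ ∫ x, pd j (pot ε i h) x ^ 2 := fun i j =>
    integral_nonneg fun x => sq_nonneg _
  refine le_trans ?_ (Finset.single_le_sum (fun i _ => Finset.sum_nonneg fun j _ => hn i j)
    (Finset.mem_univ i))
  exact Finset.single_le_sum (f := fun j => ∫ x, pd j (pot ε i h) x ^ 2) (fun j _ => hn i j)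
    (Finset.mem_univ j)

theorem integrable_pd_pot_sq (i j : Fin 3) : Integrable fun x => pd j (pot ε i h) x ^ 2 := by
  have hC1 : ContDiff ℝ 1 (pot ε i h) := contDiff_pot (n := 1) hε i (hh.of_le (by norm_num)) hc
  have := (decays_pd_pot hε hε1 hh hc i j).integrable_mul (decays_pd_pot hε hε1 hh hc i j)
    (hC1.continuous_pd j) (hC1.continuous_pd j)
  simpa only [sq] using this

/-- Hardy's inequality together with the Hessian bound. On the ball of radius 4R the Hardy weight is
at least 1/(17R²), and 68 = 17 · 4. -/
theorem setIntegral_pot_sq_le (i : Fin 3) {R : ℝ} (hR : 0 < R) :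
    ∫ x in Metric.closedBall 0 (4 * R), pot ε i h x ^ 2
      ≤ 68 * R ^ 2 * ((∫ z, mol 1 z) ^ 2 * ∫ x, h x ^ 2) := by
  have hC1 : ContDiff ℝ 1 (pot ε i h) := contDiff_pot (n := 1) hε i (hh.of_le (by norm_num)) hc
  have hd := decays_pot hε hε1 i hh.continuous hc
  have hH := integral_inv_mul_sq_le hC1 hd (decays_pd_pot hε hε1 hh hc i) hR
  have hE : ∑ j, ∫ x, pd j (pot ε i h) x ^ 2 ≤ (∫ z, mol 1 z) ^ 2 * ∫ x, h x ^ 2 :=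
    le_trans (Finset.single_le_sum (f := fun i => ∑ j, ∫ x, pd j (pot ε i h) x ^ 2)
      (fun i _ => Finset.sum_nonneg fun j _ => integral_nonneg fun x => sq_nonneg _)
      (Finset.mem_univ i)) (sum_integral_pd_pot_sq_le hε hε1 hh hc)
  have hvi : Integrable fun x => pot ε i h x ^ 2 := by
    have := hd.integrable_mul hd hC1.continuous hC1.continuous
    simpa only [sq] using this
  have hpos : ∀ x : E3, 0 < ‖x‖ ^ 2 + R ^ 2 := fun x => by positivity
  have hci : Continuous fun x : E3 => (‖x‖ ^ 2 + R ^ 2)⁻¹ :=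
    Continuous.inv₀ (by fun_prop) fun x => (hpos x).ne'
  have hWi : Integrable fun x => (‖x‖ ^ 2 + R ^ 2)⁻¹ * pot ε i h x ^ 2 := by
    refine (hvi.const_mul (R ^ 2)⁻¹).mono' (hci.mul (hC1.continuous.pow 2)).aestronglyMeasurable
      (Filter.Eventually.of_forall fun x => ?_)
    have := hpos x
    rw [Real.norm_of_nonneg (by positivity)]
    refine mul_le_mul_of_nonneg_right (inv_anti₀ (by positivity) ?_) (sq_nonneg _)
    nlinarith [sq_nonneg ‖x‖]
  calc ∫ x in Metric.closedBall 0 (4 * R), pot ε i h x ^ 2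
      ≤ ∫ x in Metric.closedBall 0 (4 * R),
          17 * R ^ 2 * ((‖x‖ ^ 2 + R ^ 2)⁻¹ * pot ε i h x ^ 2) := by
        refine setIntegral_mono_on hvi.integrableOn (hWi.const_mul _).integrableOn
          measurableSet_closedBall fun x hx => ?_
        rw [mem_closedBall_zero_iff] at hx
        rw [← mul_assoc]
        refine le_mul_of_one_le_left (sq_nonneg _) ?_
        rw [← div_eq_mul_inv, one_le_div (hpos x)]
        nlinarith [norm_nonneg x]
    _ ≤ ∫ x, 17 * R ^ 2 * ((‖x‖ ^ 2 + R ^ 2)⁻¹ * pot ε i h x ^ 2) :=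
        setIntegral_le_integral (hWi.const_mul _) (Filter.Eventually.of_forall fun x => by
          have := hpos x
          simp only [Pi.zero_apply]; positivity)
    _ ≤ _ := by
        rw [integral_const_mul]
        nlinarith [mul_le_mul_of_nonneg_left (hH.trans (mul_le_mul_of_nonneg_left hE
          (by norm_num : (0 : ℝ) ≤ 4))) (by positivity : (0 : ℝ) ≤ 17 * R ^ 2)]

end Potential

/-! ### Cutoff functions and localized potentials. -/

/-- `σ` is a smooth cutoff function, equal to `1` on the ball of radius `r` and to `0` outside the
ball of radius `2r`, with derivatives of the natural size. -/
structure IsCutoff (C r : ℝ) (σ : E3 → ℝ) : Prop where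
  contDiff : ContDiff ℝ 3 σ
  nonneg : ∀ x, 0 ≤ σ x
  le_one : ∀ x, σ x ≤ 1
  eq_one : ∀ x, ‖x‖ ≤ r → σ x = 1
  eq_zero : ∀ x, 2 * r ≤ ‖x‖ → σ x = 0
  abs_pd_le : ∀ j x, |pd j σ x| ≤ C / r
  abs_pd_pd_le : ∀ j k x, |pd k (pd j σ) x| ≤ C / r ^ 2

/-- The closed annulus of radii `R` and `4R`. -/
def annulus (R : ℝ) : Set E3 := {x | R ≤ ‖x‖ ∧ ‖x‖ ≤ 4 * R}

theorem annulus_subset (R : ℝ) : annulus R ⊆ Metric.closedBall 0 (4 * R) := fun _ hx =>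
  mem_closedBall_zero_iff.2 hx.2

theorem isClosed_annulus (R : ℝ) : IsClosed (annulus R) :=
  (isClosed_le continuous_const continuous_norm).inter (isClosed_le continuous_norm continuous_const)

theorem isCompact_annulus (R : ℝ) : IsCompact (annulus R) :=
  (isCompact_closedBall 0 (4 * R)).of_isClosed_subset (isClosed_annulus R) (annulus_subset R)

namespace IsCutoff

variable {C r : ℝ} {σ : E3 → ℝ} (h : IsCutoff C r σ)
include h

theorem hasCompactSupport : HasCompactSupport σ := by
  refine HasCompactSupport.intro (isCompact_closedBall (0 : E3) (2 * r)) fun x hx => h.eq_zero x ?_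
  rw [mem_closedBall_zero_iff, not_le] at hx
  exact hx.le

theorem pd_eq_zero_of_lt (j : Fin 3) {x : E3} (hx : ‖x‖ < r) : pd j σ x = 0 := by
  refine pd_eq_zero_of_eventuallyEq j (c := 1) ?_
  filter_upwards [(isOpen_lt continuous_norm continuous_const).mem_nhds hx] with y hy
  exact h.eq_one y (le_of_lt hy)

theorem pd_eq_zero_of_gt (j : Fin 3) {x : E3} (hx : 2 * r < ‖x‖) : pd j σ x = 0 := by
  refine pd_eq_zero_of_eventuallyEq j (c := 0) ?_
  filter_upwards [(isOpen_lt continuous_const continuous_norm).mem_nhds hx] with y hy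
  exact h.eq_zero y (le_of_lt hy)

/-- One annulus serves both cutoffs: the scales r = R and r = 2R both satisfy the two inequalities.
-/
theorem pd_eq_zero_of_notMem (j : Fin 3) {R : ℝ} (h1 : R ≤ r) (h2 : 2 * r ≤ 4 * R) {x : E3}
    (hx : x ∉ annulus R) : pd j σ x = 0 := by
  simp only [annulus, Set.mem_ofPred_eq, not_and_or, not_le] at hx
  rcases hx with hx | hx
  · exact h.pd_eq_zero_of_lt j (hx.trans_le h1)
  · exact h.pd_eq_zero_of_gt j (h2.trans_lt hx)

end IsCutoff

/-- The basic estimate for a term of T : ∇w. If the derivative hits the cutoff factor, the loss 1/R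
is compensated by the factor R of the Hardy bound; if it hits the potential, the Hessian bound
applies. The result is uniform in ε and sees T only on the support set S, which may be a ball or the
annulus. -/
theorem abs_integral_mul_pd_mul_pot_le {ε R α : ℝ} {h a T : E3 → ℝ} {S : Set E3} (hε : 0 < ε)
    (hε1 : ε ≤ 1) (hR : 0 < R) (hα : 0 ≤ α) (hh : ContDiff ℝ 2 h) (hc : HasCompactSupport h)
    (ha : ContDiff ℝ 1 a) (ha1 : ∀ x, |a x| ≤ α) (ha2 : ∀ k x, |pd k a x| ≤ α / R)
    (hS : IsCompact S) (hSb : S ⊆ Metric.closedBall 0 (4 * R)) (ha0 : ∀ x ∉ S, a x = 0)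
    (ha0' : ∀ k, ∀ x ∉ S, pd k a x = 0) (hT : Continuous T) (i k : Fin 3) :
    |∫ x, T x * pd k (fun y => a y * pot ε i h y) x|
      ≤ 10 * α * (∫ z, mol 1 z) * √(∫ x in S, T x ^ 2) * √(∫ x, h x ^ 2) := by
  set κ := ∫ z, mol 1 z with hκ
  have hκ0 : 0 < κ := integral_mol_one_pos
  set H := ∫ x, h x ^ 2 with hH
  have hH0 : 0 ≤ H := integral_nonneg fun x => sq_nonneg _
  have hV : ContDiff ℝ 1 (pot ε i h) := contDiff_pot (n := 1) hε i (hh.of_le (by norm_num)) hc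
  have hVc := hV.continuous
  have hV'c := hV.continuous_pd k
  have hac := ha.continuous
  have ha'c := ha.continuous_pd k
  have e1 : ∀ x, T x * pd k (fun y => a y * pot ε i h y) x
      = T x * (pd k a x * pot ε i h x) + T x * (a x * pd k (pot ε i h) x) := fun x => by
    rw [pd_mul k (ha.differentiable one_ne_zero x) (hV.differentiable one_ne_zero x)]; ring
  have hcs : ∀ b : E3 → ℝ, Continuous b → (∀ x ∉ S, b x = 0) → Integrable b := fun b hb hb0 =>
    hb.integrable_of_hasCompactSupport (HasCompactSupport.intro hS hb0)
  simp only [e1]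
  rw [integral_add (hcs _ (by fun_prop) fun x hx => by simp [ha0' k x hx])
    (hcs _ (by fun_prop) fun x hx => by simp [ha0 x hx])]
  have b1 := abs_integral_mul_le_of_eq_zero hT
    (by fun_prop : Continuous fun x => pd k a x * pot ε i h x) hS
    (fun x hx => by simp [ha0' k x hx])
  have b2 := abs_integral_mul_le_of_eq_zero hT
    (by fun_prop : Continuous fun x => a x * pd k (pot ε i h) x) hS
    (fun x hx => by simp [ha0 x hx])
  -- The factor 9 comes from 68 ≤ 9²; adding the factor 1 of `c2` gives the final 10.
  have c1 : √(∫ x in S, (pd k a x * pot ε i h x) ^ 2) ≤ 9 * α * κ * √H := by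
    rw [Real.sqrt_le_left (by positivity), mul_pow, Real.sq_sqrt hH0]
    have hb : IntegrableOn (fun x => pot ε i h x ^ 2) (Metric.closedBall 0 (4 * R)) :=
      (hVc.pow 2).continuousOn.integrableOn_compact (isCompact_closedBall _ _)
    calc ∫ x in S, (pd k a x * pot ε i h x) ^ 2
        ≤ ∫ x in S, (α / R) ^ 2 * pot ε i h x ^ 2 := by
          refine setIntegral_mono ((by fun_prop : Continuous fun x =>
            (pd k a x * pot ε i h x) ^ 2).continuousOn.integrableOn_compact hS)
            ((hb.mono_set hSb).const_mul _) fun x => ?_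
          simp only [mul_pow]
          refine mul_le_mul_of_nonneg_right ?_ (sq_nonneg _)
          rw [← sq_abs (pd k a x)]
          exact pow_le_pow_left₀ (abs_nonneg _) (ha2 k x) 2
      _ ≤ (α / R) ^ 2 * ∫ x in Metric.closedBall 0 (4 * R), pot ε i h x ^ 2 := by
          rw [integral_const_mul]
          refine mul_le_mul_of_nonneg_left ?_ (sq_nonneg _)
          exact setIntegral_mono_set hb (Filter.Eventually.of_forall fun x => sq_nonneg _)
            hSb.eventuallyLE
      _ ≤ (α / R) ^ 2 * (68 * R ^ 2 * (κ ^ 2 * H)) :=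
          mul_le_mul_of_nonneg_left (setIntegral_pot_sq_le hε hε1 hh hc i hR) (sq_nonneg _)
      _ = 68 * (α ^ 2 * κ ^ 2 * H) := by field_simp
      _ ≤ _ := by
          have : 0 ≤ α ^ 2 * κ ^ 2 * H := by positivity
          nlinarith
  have c2 : √(∫ x in S, (a x * pd k (pot ε i h) x) ^ 2) ≤ α * κ * √H := by
    rw [Real.sqrt_le_left (by positivity), mul_pow, Real.sq_sqrt hH0]
    have hb := integrable_pd_pot_sq hε hε1 hh hc i k
    calc ∫ x in S, (a x * pd k (pot ε i h) x) ^ 2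
        ≤ ∫ x in S, α ^ 2 * pd k (pot ε i h) x ^ 2 := by
          refine setIntegral_mono ((by fun_prop : Continuous fun x =>
            (a x * pd k (pot ε i h) x) ^ 2).continuousOn.integrableOn_compact hS)
            (hb.integrableOn.const_mul _) fun x => ?_
          simp only [mul_pow]
          refine mul_le_mul_of_nonneg_right ?_ (sq_nonneg _)
          rw [← sq_abs (a x)]
          exact pow_le_pow_left₀ (abs_nonneg _) (ha1 x) 2
      _ ≤ α ^ 2 * ∫ x, pd k (pot ε i h) x ^ 2 := by
          rw [integral_const_mul]
          exact mul_le_mul_of_nonneg_left (setIntegral_le_integral hb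
            (Filter.Eventually.of_forall fun x => sq_nonneg _)) (sq_nonneg _)
      _ ≤ α ^ 2 * (κ ^ 2 * H) :=
          mul_le_mul_of_nonneg_left (integral_pd_pot_sq_le hε hε1 hh hc i k) (sq_nonneg _)
      _ = _ := by ring
  have hT0 := Real.sqrt_nonneg (∫ x in S, T x ^ 2)
  refine (abs_add_le _ _).trans ?_
  nlinarith [b1.trans (mul_le_mul_of_nonneg_left c1 hT0),
    b2.trans (mul_le_mul_of_nonneg_left c2 hT0)]

/-! ### Elimination of the pressure. -/

/-- A gradient is orthogonal to the divergence of a compactly supported antisymmetric tensor. -/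
theorem sum_integral_pd_mul_pd_antisymm {p : E3 → ℝ} (hp : Differentiable ℝ p)
    (hp' : ∀ i, Continuous (pd i p)) {A : Fin 3 → Fin 3 → E3 → ℝ} (hA : ∀ i j, ContDiff ℝ 2 (A i j))
    (hAc : ∀ i j, HasCompactSupport (A i j)) (hanti : ∀ i j x, A j i x = - A i j x) :
    ∑ i, ∑ j, ∫ x, pd i p x * pd j (A i j) x = 0 := by
  have key : ∀ i j, ∫ x, pd i p x * pd j (A i j) x = - ∫ x, pd j p x * pd i (A j i) x := by
    -- Both derivatives end on A, since p is only known to have continuous first derivatives. The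
    -- symmetric second derivative then meets an antisymmetric tensor.
    have h1 : ∀ i j, ∫ x, pd i p x * pd j (A i j) x = - ∫ x, p x * pd i (pd j (A i j)) x := by
      intro i j
      rw [integral_mul_pd i hp (hp' i) ((hA i j).pd_one j) ((hAc i j).pd j), neg_neg]
    intro i j
    rw [h1, h1]
    have h2 : A j i = fun x => - A i j x := funext fun x => hanti i j x
    have h3 : pd i (A j i) = fun x => - pd i (A i j) x := by
      rw [h2]; exact funext fun x => pd_neg i
    have h4 : ∀ x, pd j (pd i (A j i)) x = - pd i (pd j (A i j)) x := fun x => by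
      rw [h3, pd_neg, pd_comm i (hA i j) j]
    simp only [h4, mul_neg, integral_neg, neg_neg]
  have h := Finset.sum_comm (s := Finset.univ) (t := Finset.univ)
    (f := fun i j : Fin 3 => ∫ x, pd i p x * pd j (A i j) x)
  have h5 : ∑ j, ∑ i, ∫ x, pd i p x * pd j (A i j) x
      = - ∑ i, ∑ j, ∫ x, pd i p x * pd j (A i j) x := by
    rw [← Finset.sum_neg_distrib]
    refine Finset.sum_congr rfl fun j _ => ?_
    rw [← Finset.sum_neg_distrib]
    exact Finset.sum_congr rfl fun i _ => key i j
  linarith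

section Pressure

variable {C R : ℝ} {σ χ : E3 → ℝ} {U : Fin 3 → E3 → ℝ} {T : Fin 3 → Fin 3 → E3 → ℝ}

/-- Decomposition of the solenoidal test field obtained by localizing a vector potential. -/
theorem sum_pd_mul_pot_sub_pot {ε : ℝ} (hε : 0 < ε) {g : Fin 3 → E3 → ℝ} {f : E3 → ℝ}
    (hχ : ContDiff ℝ 1 χ) (hg : ∀ i, ContDiff ℝ 1 (g i)) (hgc : ∀ i, HasCompactSupport (g i))
    (hf : ∀ x, f x = ∑ j, pd j (g j) x) (i : Fin 3) (x : E3) :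
    ∑ j, pd j (fun y => χ y * (pot ε i (g j) y - pot ε j (g i) y)) x
      = χ x * conv (mol ε) (g i) x + (χ x * pot ε i f x
        + ∑ j, (pd j χ x * pot ε i (g j) x - pd j χ x * pot ε j (g i) x)) := by
  have hP : ∀ i j, Differentiable ℝ (pot ε i (g j)) := fun i j =>
    (contDiff_pot (n := 1) hε i (hg j) (hgc j)).differentiable one_ne_zero
  have h1 : ∀ j, pd j (fun y => χ y * (pot ε i (g j) y - pot ε j (g i) y)) x
      = pd j χ x * (pot ε i (g j) x - pot ε j (g i) x)
        + χ x * (pd j (pot ε i (g j)) x - pd j (pot ε j (g i)) x) := fun j => by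
    rw [pd_mul j (hχ.differentiable one_ne_zero x) ((hP i j x).fun_sub (hP j i x)),
      pd_sub j (hP i j x) (hP j i x)]
  -- The first half of the antisymmetric tensor yields the potential of div g; the second half,
  -- through `h3`, yields the mollified g.
  have h2 : ∑ j, pd j (pot ε i (g j)) x = pot ε i f x := by
    have : f = fun x => ∑ j, pd j (g j) x := funext hf
    rw [this, pot, conv_sum _ (contDiff_potKer (n := 0) hε i).continuous
      (fun j _ => (hg j).continuous_pd j) (fun j _ => (hgc j).pd j)]
    exact Finset.sum_congr rfl fun j _ => by rw [pd_pot hε i j (hg j) (hgc j), pot]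
  have h3 := sum_pd_pot hε (hg i) (hgc i) x
  rw [Finset.sum_congr rfl fun j _ => h1 j]
  simp only [mul_sub, Finset.sum_add_distrib, Finset.sum_sub_distrib, ← Finset.mul_sum, h2, h3]
  ring

variable (hR : 0 < R) (hC : 1 ≤ C) (hσ : IsCutoff C R σ) (hχ : IsCutoff C (2 * R) χ)
  (hU : ∀ i, ContDiff ℝ 2 (U i)) (hdiv : ∀ x, ∑ j, pd j (U j) x = 0)
  (hT : ∀ i j, ContDiff ℝ 1 (T i j)) {p : E3 → ℝ} (hp : Differentiable ℝ p)
  (hpT : ∀ i x, pd i p x = - ∑ j, pd j (T i j) x)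

include hR hC hσ hχ hU hdiv hT hp hpT

/-- The pressure estimate at fixed ε. In w, the potential of f = ∇σ · U has its datum on the
annulus, while the terms with ∇χ have their coefficient there; so every product on the right has an
annulus factor. The common mass factor is kept in order to be divided out in the limit. -/
theorem abs_integral_mul_conv_mol_le {ε : ℝ} (hε : 0 < ε) (hε1 : ε ≤ 1) :
    |∫ x, ∑ i, (∑ j, pd j (T i j) x) * (χ x * conv (mol ε) (fun y => σ y * U i y) x)|
      ≤ 60 * C ^ 2 / R * (∫ z, mol 1 z) *
        ∑ i, ∑ j, (√(∫ x in Metric.closedBall 0 (4 * R), T i j x ^ 2)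
            * √(∫ x in annulus R, ∑ k, U k x ^ 2)
          + √(∫ x in annulus R, T i j x ^ 2)
            * √(∫ x in Metric.closedBall 0 (4 * R), ∑ k, U k x ^ 2)) := by
  set κ := ∫ z, mol 1 z with hκ
  have hκ0 : 0 < κ := integral_mol_one_pos
  have hC0 : 0 < C := by linarith
  have hσ2 : ContDiff ℝ 2 σ := hσ.contDiff.of_le (by norm_num)
  have hχ2 : ContDiff ℝ 2 χ := hχ.contDiff.of_le (by norm_num)
  have hχ1 : ContDiff ℝ 1 χ := hχ.contDiff.of_le (by norm_num)
  -- This is where three derivatives of the cutoffs are spent: ∂σ enters the datum f of a potential,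
  -- and data must be C².
  have hpσ : ∀ j, ContDiff ℝ 2 (pd j σ) := fun j => hσ.contDiff.pd_of_le j (by norm_num)
  have hpχ : ∀ j, ContDiff ℝ 2 (pd j χ) := fun j => hχ.contDiff.pd_of_le j (by norm_num)
  have hsc := hσ.hasCompactSupport
  have hχc := hχ.hasCompactSupport
  set g : Fin 3 → E3 → ℝ := fun i y => σ y * U i y with hgdef
  have hg : ∀ i, ContDiff ℝ 2 (g i) := fun i => hσ2.mul (hU i)
  have hg1 : ∀ i, ContDiff ℝ 1 (g i) := fun i => (hg i).of_le (by norm_num)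
  have hgc : ∀ i, HasCompactSupport (g i) := fun i => hsc.mul_right
  set f : E3 → ℝ := fun y => ∑ j, pd j σ y * U j y with hfdef
  have hf : ContDiff ℝ 2 f := ContDiff.sum fun j _ => (hpσ j).mul (hU j)
  have hσA : ∀ j, ∀ x ∉ annulus R, pd j σ x = 0 := fun j x hx =>
    hσ.pd_eq_zero_of_notMem j le_rfl (by linarith) hx
  have hχA : ∀ j, ∀ x ∉ annulus R, pd j χ x = 0 := fun j x hx =>
    hχ.pd_eq_zero_of_notMem j (by linarith) (by linarith) hx
  have hfA : ∀ x ∉ annulus R, f x = 0 := fun x hx => by simp [hfdef, hσA _ x hx]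
  have hfc : HasCompactSupport f := HasCompactSupport.intro (isCompact_annulus R) hfA
  -- As U is solenoidal, the divergence of σU is ∇σ · U.
  have hfg : ∀ x, f x = ∑ j, pd j (g j) x := by
    intro x
    have h1 : ∀ j, pd j (g j) x = pd j σ x * U j x + σ x * pd j (U j) x := fun j =>
      pd_mul j (hσ2.differentiable two_ne_zero x) ((hU j).differentiable two_ne_zero x)
    simp only [h1, Finset.sum_add_distrib, ← Finset.mul_sum, hdiv, mul_zero, add_zero, hfdef]
  have hP : ∀ i j, ContDiff ℝ 2 (pot ε i (g j)) := fun i j =>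
    contDiff_pot (n := 2) hε i (hg j) (hgc j)
  have hPf : ∀ i, ContDiff ℝ 2 (pot ε i f) := fun i => contDiff_pot (n := 2) hε i hf hfc
  have hG : ∀ i, Continuous fun x => ∑ j, pd j (T i j) x := fun i =>
    continuous_finsetSum _ fun j _ => (hT i j).continuous_pd j
  have hp' : ∀ i, Continuous (pd i p) := fun i => by
    have : pd i p = fun x => - ∑ j, pd j (T i j) x := funext fun x => hpT i x
    rw [this]; exact (hG i).neg
  set w : Fin 3 → E3 → ℝ := fun i x => χ x * pot ε i f x
        + ∑ j, (pd j χ x * pot ε i (g j) x - pd j χ x * pot ε j (g i) x) with hwdef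
  have hw : ∀ i, ContDiff ℝ 1 (w i) := fun i => by
    refine ContDiff.of_le (n := 2) ?_ (by norm_num)
    exact (hχ2.mul (hPf i)).add (ContDiff.sum fun j _ =>
      ((hpχ j).mul (hP i j)).sub ((hpχ j).mul (hP j i)))
  have hχb : ∀ x ∉ Metric.closedBall (0 : E3) (4 * R), χ x = 0 := fun x hx => by
    rw [mem_closedBall_zero_iff, not_le] at hx
    exact hχ.eq_zero x (by linarith)
  have hχ'b : ∀ j, ∀ x ∉ Metric.closedBall (0 : E3) (4 * R), pd j χ x = 0 := fun j x hx =>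
    hχA j x fun h => hx (annulus_subset R h)
  have hwc : ∀ i, HasCompactSupport (w i) := fun i =>
    HasCompactSupport.intro (isCompact_closedBall (0 : E3) (4 * R)) fun x hx => by
      simp [hwdef, hχb x hx, hχ'b _ x hx]
  have hconv : ∀ i, Continuous (conv (mol ε) (g i)) := fun i =>
    (ContDiff.conv (n := 0) (continuous_mol hε) (contDiff_zero.2 (hg i).continuous) (hgc i)).continuous
  -- the test field is orthogonal to the pressure gradient
  have horth := sum_integral_pd_mul_pd_antisymm hp hp'
    (A := fun i j y => χ y * (pot ε i (g j) y - pot ε j (g i) y))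
    (fun i j => hχ2.mul ((hP i j).sub (hP j i))) (fun i j => hχc.mul_right)
    (fun i j x => by ring)
  have hI1 : ∀ i j, Integrable fun x =>
      pd i p x * pd j (fun y => χ y * (pot ε i (g j) y - pot ε j (g i) y)) x := fun i j =>
    ((hp' i).mul (((hχ2.mul ((hP i j).sub (hP j i))).pd_one j).continuous)).integrable_of_hasCompactSupport
      ((HasCompactSupport.mul_right hχc).pd j).mul_left
  have hIm : ∀ i, Integrable fun x =>
      (∑ j, pd j (T i j) x) * (χ x * conv (mol ε) (g i) x) := fun i =>
    ((hG i).mul (hχ2.continuous.mul (hconv i))).integrable_of_hasCompactSupport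
      (HasCompactSupport.mul_right hχc).mul_left
  have hIT : ∀ i j, Integrable fun x => pd j (T i j) x * w i x := fun i j =>
    (((hT i j).continuous_pd j).mul (hw i).continuous).integrable_of_hasCompactSupport
      (hwc i).mul_left
  -- Substituting ∇p = -div T into the orthogonality relation and integrating the w part by parts
  -- removes the pressure.
  have hid : ∫ x, ∑ i, (∑ j, pd j (T i j) x) * (χ x * conv (mol ε) (g i) x)
      = ∑ i, ∑ j, ∫ x, T i j x * pd j (w i) x := by
    have e1 : ∀ i, ∑ j, ∫ x, pd i p x * pd j (fun y => χ y * (pot ε i (g j) y - pot ε j (g i) y)) x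
        = -(∫ x, (∑ j, pd j (T i j) x) * (χ x * conv (mol ε) (g i) x))
          + ∑ j, ∫ x, T i j x * pd j (w i) x := by
      intro i
      rw [← integral_finsetSum _ fun j _ => hI1 i j]
      simp only [← Finset.mul_sum, sum_pd_mul_pot_sub_pot hε hχ1 hg1 hgc hfg, hpT]
      have e2 : ∀ j, ∫ x, T i j x * pd j (w i) x = - ∫ x, pd j (T i j) x * w i x := fun j =>
        integral_mul_pd j ((hT i j).differentiable one_ne_zero) ((hT i j).continuous_pd j)
          (hw i) (hwc i)
      simp only [e2, Finset.sum_neg_distrib]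
      rw [← integral_finsetSum _ fun j _ => hIT i j, ← neg_add, ← integral_add (hIm i)
        (integrable_finsetSum _ fun j _ => hIT i j), ← integral_neg]
      refine integral_congr_ae (Filter.Eventually.of_forall fun x => ?_)
      simp only [hwdef, ← Finset.sum_mul]
      ring
    simp only [e1, Finset.sum_add_distrib, Finset.sum_neg_distrib] at horth
    rw [integral_finsetSum _ fun i _ => hIm i]
    linarith
  -- estimates
  set XA := √(∫ x in annulus R, ∑ k, U k x ^ 2) with hXA
  set XB := √(∫ x in Metric.closedBall 0 (4 * R), ∑ k, U k x ^ 2) with hXB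
  have hUc : Continuous fun x => ∑ k, U k x ^ 2 :=
    continuous_finsetSum _ fun k _ => (hU k).continuous.pow 2
  have hU0 : ∀ x, 0 ≤ ∑ k, U k x ^ 2 := fun x => Finset.sum_nonneg fun k _ => sq_nonneg _
  -- Cauchy-Schwarz in the three indices gives the factor 3, rounded up to 2².
  have hf2 : √(∫ x, f x ^ 2) ≤ 2 * C / R * XA := by
    rw [Real.sqrt_le_left (by positivity), mul_pow,
      Real.sq_sqrt (integral_nonneg hU0), ← integral_const_mul,
      ← setIntegral_eq_integral_of_forall_compl_eq_zero (s := annulus R)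
        (fun x hx => by rw [hfA x hx]; norm_num)]
    refine setIntegral_mono (((hf.continuous.pow 2).continuousOn).integrableOn_compact
      (isCompact_annulus R)) (((continuous_const.mul hUc).continuousOn).integrableOn_compact
      (isCompact_annulus R)) fun x => ?_
    have h1 : f x ^ 2 ≤ (∑ j, pd j σ x ^ 2) * ∑ k, U k x ^ 2 :=
      Finset.sum_mul_sq_le_sq_mul_sq _ _ _
    refine h1.trans (mul_le_mul_of_nonneg_right ?_ (hU0 x))
    have h2 : ∀ j, pd j σ x ^ 2 ≤ (C / R) ^ 2 := fun j => by
      rw [← sq_abs]; exact pow_le_pow_left₀ (abs_nonneg _) (hσ.abs_pd_le j x) 2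
    rw [Fin.sum_univ_three]
    have e : (2 * C / R) ^ 2 = 4 * (C / R) ^ 2 := by ring
    rw [e]
    linarith [h2 0, h2 1, h2 2, sq_nonneg (C / R)]
  have hg2 : ∀ i, √(∫ x, g i x ^ 2) ≤ XB := by
    intro i
    refine Real.sqrt_le_sqrt ?_
    rw [← setIntegral_eq_integral_of_forall_compl_eq_zero (s := Metric.closedBall 0 (4 * R))
        (fun x hx => by
          rw [mem_closedBall_zero_iff, not_le] at hx
          simp [hgdef, hσ.eq_zero x (by linarith)])]
    refine setIntegral_mono ((((hg i).continuous.pow 2).continuousOn).integrableOn_compact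
      (isCompact_closedBall _ _)) (hUc.continuousOn.integrableOn_compact
      (isCompact_closedBall _ _)) fun x => ?_
    simp only [hgdef, mul_pow]
    have h1 : σ x ^ 2 ≤ 1 := pow_le_one₀ (hσ.nonneg x) (hσ.le_one x)
    have h2 := Finset.single_le_sum (f := fun k => U k x ^ 2) (fun k _ => sq_nonneg _)
      (Finset.mem_univ i)
    nlinarith [sq_nonneg (U i x)]
  have hχ'1 : ∀ k x, |pd k χ x| ≤ C / R := fun k x => by
    refine (hχ.abs_pd_le k x).trans ?_
    gcongr; linarith
  have hχ'2 : ∀ j k x, |pd k (pd j χ) x| ≤ C / R / R := fun j k x => by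
    refine (hχ.abs_pd_pd_le j k x).trans ?_
    rw [div_div]
    gcongr; nlinarith
  have hT1 : ∀ i j, |∫ x, T i j x * pd j (w i) x|
      ≤ 60 * C ^ 2 / R * κ * (√(∫ x in Metric.closedBall 0 (4 * R), T i j x ^ 2) * XA
          + √(∫ x in annulus R, T i j x ^ 2) * XB) := by
    intro i j
    set TB := √(∫ x in Metric.closedBall 0 (4 * R), T i j x ^ 2) with hTB
    set TA := √(∫ x in annulus R, T i j x ^ 2) with hTA
    have hTB0 : 0 ≤ TB := Real.sqrt_nonneg _
    have hTA0 : 0 ≤ TA := Real.sqrt_nonneg _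
    have hXB0 : 0 ≤ XB := Real.sqrt_nonneg _
    -- Here T is taken on the whole ball, but f is small since it only sees U on the annulus; in
    -- `t2` the roles are reversed.
    have t1 : |∫ x, T i j x * pd j (fun y => χ y * pot ε i f y) x|
        ≤ 10 * C * κ * TB * √(∫ x, f x ^ 2) :=
      abs_integral_mul_pd_mul_pot_le hε hε1 hR hC0.le hf hfc hχ1
        (fun x => by rw [abs_of_nonneg (hχ.nonneg x)]; exact (hχ.le_one x).trans hC) hχ'1
        (isCompact_closedBall _ _) subset_rfl hχb hχ'b (hT i j).continuous i j
    have hpχ0 : ∀ k l, ∀ x ∉ annulus R, pd l (pd k χ) x = 0 := by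
      intro k l x hx
      refine pd_eq_zero_of_eventuallyEq l (c := 0) ?_
      filter_upwards [(isClosed_annulus R).isOpen_compl.mem_nhds hx] with y hy
      exact hχA k y hy
    have t2 : ∀ k a b, |∫ x, T i j x * pd j (fun y => pd k χ y * pot ε a (g b) y) x|
        ≤ 10 * (C / R) * κ * TA * √(∫ x, g b x ^ 2) := fun k a b =>
      abs_integral_mul_pd_mul_pot_le hε hε1 hR (by positivity) (hg b) (hgc b)
        ((hpχ k).of_le (by norm_num)) (hχ'1 k) (hχ'2 k)
        (isCompact_annulus R) (annulus_subset R) (hχA k) (hpχ0 k) (hT i j).continuous a j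
    have t3 : ∀ k a b, |∫ x, T i j x * pd j (fun y => pd k χ y * pot ε a (g b) y) x|
        ≤ 10 * (C / R) * κ * TA * XB := fun k a b =>
      (t2 k a b).trans (mul_le_mul_of_nonneg_left (hg2 b) (by positivity))
    have d1 : Differentiable ℝ fun y => χ y * pot ε i f y :=
      (hχ2.mul (hPf i)).differentiable two_ne_zero
    have d2 : ∀ k a b, ContDiff ℝ 2 fun y => pd k χ y * pot ε a (g b) y := fun k a b =>
      (hpχ k).mul (hP a b)
    have d2' : ∀ k a b, Differentiable ℝ fun y => pd k χ y * pot ε a (g b) y := fun k a b =>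
      (d2 k a b).differentiable two_ne_zero
    have e1 : ∀ x, T i j x * pd j (w i) x = T i j x * pd j (fun y => χ y * pot ε i f y) x
        + ∑ k, (T i j x * pd j (fun y => pd k χ y * pot ε i (g k) y) x
          - T i j x * pd j (fun y => pd k χ y * pot ε k (g i) y) x) := by
      intro x
      have e2 : pd j (w i) x = pd j (fun y => χ y * pot ε i f y) x
        + ∑ k, (pd j (fun y => pd k χ y * pot ε i (g k) y) x
          - pd j (fun y => pd k χ y * pot ε k (g i) y) x) := by
        simp only [hwdef]
        rw [pd_add j (d1 x) (DifferentiableAt.fun_sum fun k _ =>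
          ((d2' k i k x).fun_sub (d2' k k i x))), pd_sum j _ fun k _ =>
          ((d2' k i k x).fun_sub (d2' k k i x))]
        simp only [pd_sub j (d2' _ _ _ x) (d2' _ _ _ x)]
      rw [e2, mul_add, Finset.mul_sum]
      simp only [mul_sub]
    have i1 : Integrable fun x => T i j x * pd j (fun y => χ y * pot ε i f y) x :=
      ((hT i j).continuous.mul (((hχ2.mul (hPf i)).pd_one j).continuous)).integrable_of_hasCompactSupport
        ((HasCompactSupport.mul_right hχc).pd j).mul_left
    have i2 : ∀ k a b, Integrable fun x =>
        T i j x * pd j (fun y => pd k χ y * pot ε a (g b) y) x := fun k a b =>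
      ((hT i j).continuous.mul (((d2 k a b).pd_one j).continuous)).integrable_of_hasCompactSupport
        ((HasCompactSupport.mul_right (hχc.pd k)).pd j).mul_left
    have i3 : ∀ k, Integrable fun x =>
        T i j x * pd j (fun y => pd k χ y * pot ε i (g k) y) x
          - T i j x * pd j (fun y => pd k χ y * pot ε k (g i) y) x := fun k =>
      (i2 k i k).sub (i2 k k i)
    simp only [e1]
    rw [integral_add i1 (integrable_finsetSum _ fun k _ => i3 k),
      integral_finsetSum _ fun k _ => i3 k]
    simp only [integral_sub (i2 _ _ _) (i2 _ _ _)]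
    have s1 : |∑ k, ((∫ x, T i j x * pd j (fun y => pd k χ y * pot ε i (g k) y) x)
        - ∫ x, T i j x * pd j (fun y => pd k χ y * pot ε k (g i) y) x)|
        ≤ ∑ k : Fin 3, 2 * (10 * (C / R) * κ * TA * XB) := by
      refine (Finset.abs_sum_le_sum_abs _ _).trans (Finset.sum_le_sum fun k _ => ?_)
      refine (abs_sub _ _).trans ?_
      linarith [t3 k i k, t3 k k i]
    have t1' := t1.trans (mul_le_mul_of_nonneg_left hf2 (by positivity))
    refine (abs_add_le _ _).trans ((add_le_add t1' s1).trans ?_)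
    simp only [Finset.sum_const, Finset.card_univ, Fintype.card_fin, nsmul_eq_mul]
    have q1 : 0 ≤ C ^ 2 / R * κ * TB * XA := by positivity
    -- C ≥ 1 allows both kinds of terms to share the prefactor C²/R.
    have q2 : C / R * (κ * TA * XB) ≤ C ^ 2 / R * (κ * TA * XB) := by
      gcongr; nlinarith
    have e3 : 10 * C * κ * TB * (2 * C / R * XA) = 20 * (C ^ 2 / R * κ * TB * XA) := by ring
    rw [e3]
    push_cast
    calc _ = 20 * (C ^ 2 / R * κ * TB * XA) + 60 * (C / R * (κ * TA * XB)) := by ring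
      _ ≤ 60 * (C ^ 2 / R * κ * TB * XA) + 60 * (C ^ 2 / R * (κ * TA * XB)) := by linarith
      _ = _ := by ring
  rw [hid]
  refine (Finset.abs_sum_le_sum_abs _ _).trans ?_
  rw [Finset.mul_sum]
  refine Finset.sum_le_sum fun i _ => (Finset.abs_sum_le_sum_abs _ _).trans ?_
  rw [Finset.mul_sum]
  exact Finset.sum_le_sum fun j _ => hT1 i j

/-- The local pressure estimate: the work of the pressure gradient against the cut-off solenoidal
field is controlled by local `L²` norms of the stress tensor and of the field. -/
theorem abs_integral_cutoff_mul_le :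
    |∫ x, σ x * ∑ i, U i x * ∑ j, pd j (T i j) x|
      ≤ 60 * C ^ 2 / R *
        ∑ i, ∑ j, (√(∫ x in Metric.closedBall 0 (4 * R), T i j x ^ 2)
            * √(∫ x in annulus R, ∑ k, U k x ^ 2)
          + √(∫ x in annulus R, T i j x ^ 2)
            * √(∫ x in Metric.closedBall 0 (4 * R), ∑ k, U k x ^ 2)) := by
  set κ := ∫ z, mol 1 z with hκ
  have hκ0 : 0 < κ := integral_mol_one_pos
  set g : Fin 3 → E3 → ℝ := fun i y => σ y * U i y with hgdef
  have hgcont : ∀ i, Continuous (g i) := fun i => hσ.contDiff.continuous.mul (hU i).continuous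
  have hgc : ∀ i, HasCompactSupport (g i) := fun i => hσ.hasCompactSupport.mul_right
  have hM : ∃ M, ∀ i x, |g i x| ≤ M := by
    choose M hM using fun i => (hgcont i).bounded_above_of_compact_support (hgc i)
    refine ⟨∑ i, |M i|, fun i x => ((hM i x).trans (le_abs_self _)).trans ?_⟩
    exact Finset.single_le_sum (f := fun i => |M i|) (fun i _ => abs_nonneg _) (Finset.mem_univ i)
  obtain ⟨M, hM⟩ := hM
  -- A sequence in (0, 1], since the decay bound of the kernel assumes ε ≤ 1.
  set e : ℕ → ℝ := fun n => 1 / ((n : ℝ) + 1) with he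
  have he0 : ∀ n, 0 < e n := fun n => Nat.one_div_pos_of_nat
  have he1 : ∀ n, e n ≤ 1 := fun n => by
    rw [he, div_le_one (by positivity)]; linarith [(Nat.cast_nonneg n : (0 : ℝ) ≤ n)]
  have het : Filter.Tendsto e Filter.atTop (nhds 0) := tendsto_one_div_add_atTop_nhds_zero_nat
  have hG : ∀ i, Continuous fun x => ∑ j, pd j (T i j) x := fun i =>
    continuous_finsetSum _ fun j _ => (hT i j).continuous_pd j
  have hχc := hχ.contDiff.continuous
  have hconv : ∀ i n, Continuous (conv (mol (e n)) (g i)) := fun i n =>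
    (ContDiff.conv (n := 0) (continuous_mol (he0 n)) (contDiff_zero.2 (hgcont i)) (hgc i)).continuous
  have hlim : Filter.Tendsto (fun n => ∫ x, ∑ i, (∑ j, pd j (T i j) x)
      * (χ x * conv (mol (e n)) (g i) x)) Filter.atTop
      (nhds (∫ x, ∑ i, (∑ j, pd j (T i j) x) * (χ x * (κ * g i x)))) := by
    refine tendsto_integral_of_dominated_convergence
      (fun x => ∑ i, |∑ j, pd j (T i j) x| * (|χ x| * (κ * M))) (fun n => ?_) ?_ (fun n => ?_) ?_
    · exact (continuous_finsetSum _ fun i _ =>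
        (hG i).mul (hχc.mul (hconv i n))).aestronglyMeasurable
    · refine integrable_finsetSum _ fun i _ => ?_
      refine ((hG i).abs.mul (hχc.abs.mul continuous_const)).integrable_of_hasCompactSupport ?_
      exact (hχ.hasCompactSupport.abs.mul_right).mul_left
    · refine Filter.Eventually.of_forall fun x => ?_
      refine (norm_sum_le _ _).trans (Finset.sum_le_sum fun i _ => ?_)
      rw [Real.norm_eq_abs, abs_mul, abs_mul]
      gcongr
      exact abs_conv_mol_le (he0 n) (hM i) x
    · refine Filter.Eventually.of_forall fun x => ?_
      exact tendsto_finsetSum _ fun i _ => ((tendsto_conv_mol (hgcont i) (hM i) he0 het x).const_mul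
        (χ x)).const_mul (∑ j, pd j (T i j) x)
  have hle := le_of_tendsto hlim.abs (Filter.Eventually.of_forall fun n =>
    abs_integral_mul_conv_mol_le hR hC hσ hχ hU hdiv hT hp hpT (he0 n) (he1 n))
  -- χ equals 1 on the support of σ, so in the limit the auxiliary cutoff disappears.
  have hχσ : ∀ x, χ x * σ x = σ x := by
    intro x
    rcases le_total ‖x‖ (2 * R) with hx | hx
    · rw [hχ.eq_one x hx, one_mul]
    · rw [hσ.eq_zero x hx, mul_zero]
  have heq : ∫ x, ∑ i, (∑ j, pd j (T i j) x) * (χ x * (κ * g i x))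
      = κ * ∫ x, σ x * ∑ i, U i x * ∑ j, pd j (T i j) x := by
    rw [← integral_const_mul]
    refine integral_congr_ae (Filter.Eventually.of_forall fun x => ?_)
    simp only [Finset.mul_sum (s := Finset.univ) (f := fun i => U i x * _), hgdef]
    rw [Finset.mul_sum]
    refine Finset.sum_congr rfl fun i _ => ?_
    linear_combination (κ * U i x * ∑ j, pd j (T i j) x) * hχσ x
  rw [heq, abs_mul, abs_of_pos hκ0] at hle
  refine le_of_mul_le_mul_left (hle.trans_eq ?_) hκ0
  ring

end Pressure

/-! ### Existence of cutoffs at every scale. -/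

theorem pd_comp_smul {f : E3 → ℝ} (hf : Differentiable ℝ f) (c : ℝ) (j : Fin 3) (x : E3) :
    pd j (fun y => f (c • y)) x = c * pd j f (c • x) := by
  have h1 : HasFDerivAt (fun y : E3 => c • y) (c • ContinuousLinearMap.id ℝ E3) x :=
    (hasFDerivAt_id x).const_smul c
  have h2 := (hf (c • x)).hasFDerivAt.comp x h1
  have h3 : (f ∘ fun y => c • y) = fun y => f (c • y) := rfl
  rw [pd, ← h3, h2.fderiv]; simp [pd]

/-- Dilating one fixed bump makes C independent of r; the leading 1 in the constant provides C ≥ 1.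
-/
theorem exists_isCutoff : ∃ C, 1 ≤ C ∧ ∀ r : ℝ, 0 < r → ∃ σ, IsCutoff C r σ := by
  let b : ContDiffBump (0 : E3) := ⟨1, 2, one_pos, one_lt_two⟩
  have hb : ContDiff ℝ 3 b := b.contDiff
  have hb1 : ∀ j, ContDiff ℝ 2 (pd j b) := fun j => hb.pd_of_le j (by norm_num)
  have hbc : HasCompactSupport b := b.hasCompactSupport
  choose M1 hM1 using fun j => (hb1 j).continuous.bounded_above_of_compact_support (hbc.pd j)
  choose M2 hM2 using fun j k => ((hb1 j).pd_one k).continuous.bounded_above_of_compact_support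
    ((hbc.pd j).pd k)
  have hs1 : ∀ j, |M1 j| ≤ ∑ j, |M1 j| := fun j =>
    Finset.single_le_sum (f := fun j => |M1 j|) (fun j _ => abs_nonneg _) (Finset.mem_univ j)
  have hs2 : ∀ j k, |M2 j k| ≤ ∑ j, ∑ k, |M2 j k| := fun j k =>
    (Finset.single_le_sum (f := fun k => |M2 j k|) (fun k _ => abs_nonneg _)
      (Finset.mem_univ k)).trans (Finset.single_le_sum (f := fun j => ∑ k, |M2 j k|)
      (fun j _ => Finset.sum_nonneg fun k _ => abs_nonneg _) (Finset.mem_univ j))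
  have h1 : 0 ≤ ∑ j, |M1 j| := Finset.sum_nonneg fun j _ => abs_nonneg _
  have h2 : 0 ≤ ∑ j, ∑ k, |M2 j k| :=
    Finset.sum_nonneg fun j _ => Finset.sum_nonneg fun k _ => abs_nonneg _
  refine ⟨1 + (∑ j, |M1 j|) + ∑ j, ∑ k, |M2 j k|, by linarith, fun r hr => ?_⟩
  have hn : ∀ x : E3, ‖r⁻¹ • x‖ = ‖x‖ / r := fun x => by
    rw [norm_smul, Real.norm_of_nonneg (inv_nonneg.2 hr.le), inv_mul_eq_div]
  have hp1 : ∀ j x, pd j (fun y => b (r⁻¹ • y)) x = r⁻¹ * pd j b (r⁻¹ • x) :=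
    pd_comp_smul (hb.differentiable (by norm_num)) _
  refine ⟨fun x => b (r⁻¹ • x), ⟨hb.comp (contDiff_id.const_smul _), fun x => b.nonneg,
    fun x => b.le_one, fun x hx => ?_, fun x hx => ?_, fun j x => ?_, fun j k x => ?_⟩⟩
  · refine b.one_of_mem_closedBall ?_
    rw [mem_closedBall_zero_iff, hn]
    exact (div_le_one hr).2 hx
  · refine b.zero_of_le_dist ?_
    rw [dist_zero_right, hn]
    exact (le_div_iff₀ hr).2 hx
  · rw [hp1, abs_mul, abs_of_pos (inv_pos.2 hr), inv_mul_eq_div]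
    refine div_le_div_of_nonneg_right ?_ hr.le
    have := (hM1 j (r⁻¹ • x)).trans ((le_abs_self _).trans (hs1 j))
    rw [Real.norm_eq_abs] at this
    linarith
  · have hp2 : pd j (fun y => b (r⁻¹ • y)) = fun x => r⁻¹ * pd j b (r⁻¹ • x) := funext (hp1 j)
    have hd : Differentiable ℝ fun x => pd j b (r⁻¹ • x) :=
      ((hb1 j).differentiable two_ne_zero).comp (differentiable_id.const_smul r⁻¹)
    rw [hp2, pd_const_mul k _ (hd x), pd_comp_smul ((hb1 j).differentiable two_ne_zero),
      abs_mul, abs_mul, abs_of_pos (inv_pos.2 hr), ← mul_assoc, ← mul_inv, ← sq, inv_mul_eq_div]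
    refine div_le_div_of_nonneg_right ?_ (sq_nonneg r)
    have := (hM2 j k (r⁻¹ • x)).trans ((le_abs_self _).trans (hs2 j k))
    rw [Real.norm_eq_abs] at this
    linarith

/-! ### The system in components and its energy balance. -/

/-- The stationary Hall-MHD system, written in components; `J` is the curl of `B`. -/
structure HallComponents (ν : ℝ) (U B J : Fin 3 → E3 → ℝ) (p : E3 → ℝ) : Prop where
  contDiff_U : ∀ i, ContDiff ℝ 2 (U i)
  contDiff_B : ∀ i, ContDiff ℝ 2 (B i)
  differentiable_p : Differentiable ℝ p
  J_zero : J 0 = fun x => pd 1 (B 2) x - pd 2 (B 1) x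
  J_one : J 1 = fun x => pd 2 (B 0) x - pd 0 (B 2) x
  J_two : J 2 = fun x => pd 0 (B 1) x - pd 1 (B 0) x
  momentum : ∀ i x, ∑ j, U j x * pd j (U i) x + pd i p x
    = ∑ j, B j x * (pd j (B i) x - pd i (B j) x) + ν * ∑ j, pd j (pd j (U i)) x
  div_U : ∀ x, ∑ j, pd j (U j) x = 0
  div_B : ∀ x, ∑ j, pd j (B j) x = 0
  induction_eq : ∀ i x, ∑ j, pd j (fun y => (J i y * B j y - J j y * B i y)
    - (U i y * B j y - U j y * B i y)) x = ∑ j, pd j (pd j (B i)) x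

/-- The total stress tensor, without the pressure. -/
noncomputable def stress (ν : ℝ) (U B : Fin 3 → E3 → ℝ) (i j : Fin 3) (x : E3) : ℝ :=
  U i x * U j x - B i x * B j x + (if i = j then 1 / 2 else 0) * (∑ k, B k x * B k x)
    - ν * pd j (U i) x

/-- The energy flux, without the pressure. -/
noncomputable def flux (ν : ℝ) (U B J : Fin 3 → E3 → ℝ) (j : Fin 3) (x : E3) : ℝ :=
  ∑ i, (-(1 / 2) * (U j x * (U i x * U i x)) + ν * (U i x * pd j (U i) x)
    + B i x * (pd j (B i) x
      - ((J i x * B j x - J j x * B i x) - (U i x * B j x - U j x * B i x))))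

namespace HallComponents

variable {ν : ℝ} {U B J : Fin 3 → E3 → ℝ} {p : E3 → ℝ} (h : HallComponents ν U B J p)
include h

theorem contDiff_J (i : Fin 3) : ContDiff ℝ 1 (J i) := by
  have hB := fun i j => (h.contDiff_B i).pd_one j
  fin_cases i
  · exact h.J_zero ▸ (hB _ _).sub (hB _ _)
  · exact h.J_one ▸ (hB _ _).sub (hB _ _)
  · exact h.J_two ▸ (hB _ _).sub (hB _ _)

theorem contDiff_stress (i j : Fin 3) : ContDiff ℝ 1 (stress ν U B i j) := by
  have hU := fun i => (h.contDiff_U i).of_le (show (1 : WithTop ℕ∞) ≤ 2 by norm_num)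
  have hB := fun i => (h.contDiff_B i).of_le (show (1 : WithTop ℕ∞) ≤ 2 by norm_num)
  exact ((((hU i).mul (hU j)).sub ((hB i).mul (hB j))).add
    (contDiff_const.mul (ContDiff.sum fun k _ => (hB k).mul (hB k)))).sub
    (contDiff_const.mul ((h.contDiff_U i).pd_one j))

theorem contDiff_flux (j : Fin 3) : ContDiff ℝ 1 (flux ν U B J j) := by
  have hU := fun i => (h.contDiff_U i).of_le (show (1 : WithTop ℕ∞) ≤ 2 by norm_num)
  have hB := fun i => (h.contDiff_B i).of_le (show (1 : WithTop ℕ∞) ≤ 2 by norm_num)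
  have hJ := h.contDiff_J
  refine ContDiff.sum fun i _ => ?_
  exact ((contDiff_const.mul ((hU j).mul ((hU i).mul (hU i)))).add (contDiff_const.mul
    ((hU i).mul ((h.contDiff_U i).pd_one j)))).add ((hB i).mul (((h.contDiff_B i).pd_one j).sub
    ((((hJ i).mul (hB j)).sub ((hJ j).mul (hB i))).sub
      (((hU i).mul (hB j)).sub ((hU j).mul (hB i))))))

theorem pd_stress (i j : Fin 3) (x : E3) : pd j (stress ν U B i j) x
    = pd j (U i) x * U j x + U i x * pd j (U j) x - (pd j (B i) x * B j x + B i x * pd j (B j) x)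
      + (if i = j then 1 / 2 else 0) * (∑ k, 2 * (B k x * pd j (B k) x))
      - ν * pd j (pd j (U i)) x := by
  have dU := fun i => (h.contDiff_U i).differentiable two_ne_zero
  have dB := fun i => (h.contDiff_B i).differentiable two_ne_zero
  have dpU := ((h.contDiff_U i).pd_one j).differentiable one_ne_zero
  have dS : Differentiable ℝ fun x => ∑ k, B k x * B k x :=
    Differentiable.fun_sum fun k _ => (dB k).fun_mul (dB k)
  unfold stress
  rw [pd_sub j ((((dU i x).fun_mul (dU j x)).fun_sub ((dB i x).fun_mul (dB j x))).fun_add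
      ((dS x).const_mul _)) ((dpU x).const_mul ν),
    pd_add j (((dU i x).fun_mul (dU j x)).fun_sub ((dB i x).fun_mul (dB j x)))
      ((dS x).const_mul _),
    pd_sub j ((dU i x).fun_mul (dU j x)) ((dB i x).fun_mul (dB j x)), pd_mul j (dU i x) (dU j x),
    pd_mul j (dB i x) (dB j x), pd_const_mul j _ (dS x), pd_const_mul j _ (dpU x),
    pd_sum j _ fun k _ => (dB k x).fun_mul (dB k x)]
  have e : ∀ k, pd j (fun y => B k y * B k y) x = 2 * (B k x * pd j (B k) x) := fun k => by
    rw [pd_mul j (dB k x) (dB k x)]; ring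
  simp only [e]

/-- The momentum equation in divergence form. Solenoidality of U and B turns the convective terms
into divergences, and the diagonal term |B|²/2 of the stress is the magnetic pressure. -/
theorem pd_p (i : Fin 3) (x : E3) : pd i p x = - ∑ j, pd j (stress ν U B i j) x := by
  have hm := h.momentum i x
  have hu := h.div_U x
  have hb := h.div_B x
  simp only [h.pd_stress]
  simp only [Fin.sum_univ_three] at *
  fin_cases i <;> simp at *
  · linear_combination hm + (U 0 x) * hu - (B 0 x) * hb
  · linear_combination hm + (U 1 x) * hu - (B 1 x) * hb
  · linear_combination hm + (U 2 x) * hu - (B 2 x) * hb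

theorem pd_flux (j : Fin 3) (x : E3) : pd j (flux ν U B J j) x
    = ∑ i, (-(1 / 2) * (pd j (U j) x * U i x ^ 2 + U j x * (2 * (U i x * pd j (U i) x)))
      + ν * (pd j (U i) x ^ 2 + U i x * pd j (pd j (U i)) x)
      + (pd j (B i) x * (pd j (B i) x
      - ((J i x * B j x - J j x * B i x) - (U i x * B j x - U j x * B i x)))
      + B i x * (pd j (pd j (B i)) x - pd j (fun y => (J i y * B j y - J j y * B i y)
        - (U i y * B j y - U j y * B i y)) x))) := by
  have dU := fun i => (h.contDiff_U i).differentiable two_ne_zero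
  have dB := fun i => (h.contDiff_B i).differentiable two_ne_zero
  have dJ := fun i => (h.contDiff_J i).differentiable one_ne_zero
  have dpU := fun i => ((h.contDiff_U i).pd_one j).differentiable one_ne_zero
  have dpB := fun i => ((h.contDiff_B i).pd_one j).differentiable one_ne_zero
  have d1 : ∀ i, DifferentiableAt ℝ (fun x => U j x * (U i x * U i x)) x := fun i =>
    (dU j x).fun_mul ((dU i x).fun_mul (dU i x))
  have d2 : ∀ i, DifferentiableAt ℝ (fun x => U i x * pd j (U i) x) x := fun i =>
    (dU i x).fun_mul (dpU i x)
  have d3 : ∀ i, DifferentiableAt ℝ (fun x => (J i x * B j x - J j x * B i x)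
      - (U i x * B j x - U j x * B i x)) x := fun i =>
    (((dJ i x).fun_mul (dB j x)).fun_sub ((dJ j x).fun_mul (dB i x))).fun_sub
      (((dU i x).fun_mul (dB j x)).fun_sub ((dU j x).fun_mul (dB i x)))
  have d4 : ∀ i, DifferentiableAt ℝ (fun x => pd j (B i) x - ((J i x * B j x - J j x * B i x)
      - (U i x * B j x - U j x * B i x))) x := fun i => (dpB i x).fun_sub (d3 i)
  have d5 : ∀ i, DifferentiableAt ℝ (fun x => -(1 / 2) * (U j x * (U i x * U i x))
      + ν * (U i x * pd j (U i) x)) x := fun i => ((d1 i).const_mul _).fun_add ((d2 i).const_mul _)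
  have d6 : ∀ i, DifferentiableAt ℝ (fun x => B i x * (pd j (B i) x
      - ((J i x * B j x - J j x * B i x) - (U i x * B j x - U j x * B i x)))) x := fun i =>
    (dB i x).fun_mul (d4 i)
  unfold flux
  rw [pd_sum j _ fun i _ => (d5 i).fun_add (d6 i)]
  refine Finset.sum_congr rfl fun i _ => ?_
  rw [pd_add j (d5 i) (d6 i), pd_add j ((d1 i).const_mul _) ((d2 i).const_mul _),
    pd_const_mul j _ (d1 i), pd_const_mul j _ (d2 i), pd_mul j (dU j x) ((dU i x).fun_mul (dU i x)),
    pd_mul j (dU i x) (dU i x), pd_mul j (dU i x) (dpU i x), pd_mul j (dB i x) (d4 i),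
    pd_sub j (dpB i x) (d3 i)]
  ring

/-- The local energy balance. -/
theorem sum_pd_flux (x : E3) : ∑ j, pd j (flux ν U B J j) x
    = ν * (∑ i, ∑ j, pd j (U i) x ^ 2) + (∑ i, ∑ j, pd j (B i) x ^ 2)
      - ∑ i, U i x * ∑ j, pd j (stress ν U B i j) x := by
  have hG : ∀ i, ∑ j, pd j (stress ν U B i j) x = ∑ j, U j x * pd j (U i) x
      - (∑ j, B j x * (pd j (B i) x - pd i (B j) x) + ν * ∑ j, pd j (pd j (U i)) x) := fun i => by
    linear_combination h.pd_p i x - h.momentum i x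
  have hu := h.div_U x
  have hi0 := h.induction_eq 0 x
  have hi1 := h.induction_eq 1 x
  have hi2 := h.induction_eq 2 x
  have j0 := congrFun h.J_zero x
  have j1 := congrFun h.J_one x
  have j2 := congrFun h.J_two x
  simp only [hG, h.pd_flux]
  simp only [Fin.sum_univ_three] at *
  simp only [j0, j1, j2]
  -- Once J is written through ∇B, the contractions of ∇B with J × B and u × B cancel identically;
  -- only div U = 0 and the induction equation paired with B are needed.
  linear_combination (-(1 / 2) * (U 0 x ^ 2 + U 1 x ^ 2 + U 2 x ^ 2)) * hu
    - B 0 x * hi0 - B 1 x * hi1 - B 2 x * hi2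

end HallComponents

/-! ### Pointwise bounds and the local energy inequality. -/

/-- The pointwise Euclidean length of the pair of fields. -/
noncomputable def fieldNorm (U B : Fin 3 → E3 → ℝ) (x : E3) : ℝ := √(∑ i, (U i x ^ 2 + B i x ^ 2))

/-- The pointwise Frobenius norm of the pair of gradients. -/
noncomputable def gradNorm (U B : Fin 3 → E3 → ℝ) (x : E3) : ℝ :=
  √(∑ i, ∑ j, (pd j (U i) x ^ 2 + pd j (B i) x ^ 2))

section Bounds

variable {U B : Fin 3 → E3 → ℝ} {x : E3}

theorem fieldNorm_sq : fieldNorm U B x ^ 2 = ∑ i, (U i x ^ 2 + B i x ^ 2) :=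
  Real.sq_sqrt (Finset.sum_nonneg fun i _ => by positivity)

theorem gradNorm_sq :
    gradNorm U B x ^ 2 = ∑ i, ∑ j, (pd j (U i) x ^ 2 + pd j (B i) x ^ 2) :=
  Real.sq_sqrt (Finset.sum_nonneg fun i _ => Finset.sum_nonneg fun j _ => by positivity)

theorem abs_le_fieldNorm (i : Fin 3) : |U i x| ≤ fieldNorm U B x ∧ |B i x| ≤ fieldNorm U B x := by
  have h := Finset.single_le_sum (f := fun i => U i x ^ 2 + B i x ^ 2)
    (fun i _ => by positivity) (Finset.mem_univ i)
  exact ⟨Real.abs_le_sqrt (by nlinarith [sq_nonneg (B i x)]),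
    Real.abs_le_sqrt (by nlinarith [sq_nonneg (U i x)])⟩

theorem abs_le_gradNorm (i j : Fin 3) :
    |pd j (U i) x| ≤ gradNorm U B x ∧ |pd j (B i) x| ≤ gradNorm U B x := by
  have h := (Finset.single_le_sum (f := fun j => pd j (U i) x ^ 2 + pd j (B i) x ^ 2)
    (fun j _ => by positivity) (Finset.mem_univ j)).trans (Finset.single_le_sum
    (f := fun i => ∑ j, (pd j (U i) x ^ 2 + pd j (B i) x ^ 2))
    (fun i _ => Finset.sum_nonneg fun j _ => by positivity) (Finset.mem_univ i))
  exact ⟨Real.abs_le_sqrt (by nlinarith [sq_nonneg (pd j (B i) x)]),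
    Real.abs_le_sqrt (by nlinarith [sq_nonneg (pd j (U i) x)])⟩

theorem fieldNorm_nonneg : 0 ≤ fieldNorm U B x := Real.sqrt_nonneg _

theorem gradNorm_nonneg : 0 ≤ gradNorm U B x := Real.sqrt_nonneg _

end Bounds

theorem abs_mul_le_mul {a b c d : ℝ} (h1 : |a| ≤ c) (h2 : |b| ≤ d) : |a * b| ≤ c * d := by
  rw [abs_mul]; exact mul_le_mul h1 h2 (abs_nonneg _) ((abs_nonneg _).trans h1)

theorem abs_stress_le {ν : ℝ} {U B : Fin 3 → E3 → ℝ} (hν : 0 < ν) (i j : Fin 3) (x : E3) :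
    |stress ν U B i j x| ≤ 4 * (1 + ν) * (fieldNorm U B x ^ 2 + gradNorm U B x) := by
  have hu := fun i => (abs_le_fieldNorm (U := U) (B := B) (x := x) i).1
  have hb := fun i => (abs_le_fieldNorm (U := U) (B := B) (x := x) i).2
  have hg := (abs_le_gradNorm (U := U) (B := B) (x := x) i j).1
  have ht := gradNorm_nonneg (U := U) (B := B) (x := x)
  have hs := fieldNorm_nonneg (U := U) (B := B) (x := x)
  set s := fieldNorm U B x
  set t := gradNorm U B x
  have h1 := abs_mul_le_mul (hu i) (hu j)
  have h2 := abs_mul_le_mul (hb i) (hb j)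
  have h3 : |(if i = j then (1 : ℝ) / 2 else 0) * ∑ k, B k x * B k x| ≤ 1 / 2 * (3 * (s * s)) := by
    refine abs_mul_le_mul (by split_ifs <;> norm_num) ((Finset.abs_sum_le_sum_abs _ _).trans ?_)
    refine (Finset.sum_le_sum fun k _ => abs_mul_le_mul (hb k) (hb k)).trans ?_
    simp
  have h4 : |ν * pd j (U i) x| ≤ ν * t := by
    rw [abs_mul, abs_of_pos hν]; exact mul_le_mul_of_nonneg_left hg hν.le
  have h5 : |stress ν U B i j x| ≤ s * s + s * s + 1 / 2 * (3 * (s * s)) + ν * t := by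
    unfold stress
    refine (abs_sub _ _).trans (add_le_add ((abs_add_le _ _).trans (add_le_add
      ((abs_sub _ _).trans (add_le_add h1 h2)) h3)) h4)
  nlinarith [mul_nonneg hν.le ht, mul_nonneg hν.le (mul_nonneg hs hs), mul_nonneg hs hs]

namespace HallComponents

variable {ν : ℝ} {U B J : Fin 3 → E3 → ℝ} {p : E3 → ℝ} (h : HallComponents ν U B J p)

include h

theorem continuous_fieldNorm : Continuous (fieldNorm U B) :=
  (continuous_finsetSum _ fun i _ => ((h.contDiff_U i).continuous.pow 2).add
    ((h.contDiff_B i).continuous.pow 2)).sqrt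

theorem continuous_gradNorm : Continuous (gradNorm U B) :=
  (continuous_finsetSum _ fun i _ => continuous_finsetSum _ fun j _ =>
    (((h.contDiff_U i).pd_one j).continuous.pow 2).add
    (((h.contDiff_B i).pd_one j).continuous.pow 2)).sqrt

theorem abs_J_le (i : Fin 3) (x : E3) : |J i x| ≤ 2 * gradNorm U B x := by
  have hb := fun i j => (abs_le_gradNorm (U := U) (B := B) (x := x) i j).2
  fin_cases i
  · simp only [Fin.zero_eta, h.J_zero]; exact (abs_sub _ _).trans (by linarith [hb 2 1, hb 1 2])
  · simp only [Fin.mk_one, h.J_one]; exact (abs_sub _ _).trans (by linarith [hb 0 2, hb 2 0])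
  · simp only [Fin.reduceFinMk, h.J_two]; exact (abs_sub _ _).trans (by linarith [hb 1 0, hb 0 1])

/-- The three terms are the kinetic and induction transport, the diffusive flux, and the Hall flux,
the last being quadratic in B times ∇B. -/
theorem abs_flux_le (hν : 0 < ν) (j : Fin 3) (x : E3) :
    |flux ν U B J j x| ≤ 12 * (1 + ν) * (fieldNorm U B x * fieldNorm U B x ^ 2
      + fieldNorm U B x * gradNorm U B x + fieldNorm U B x ^ 2 * gradNorm U B x) := by
  have hu := fun i => (abs_le_fieldNorm (U := U) (B := B) (x := x) i).1
  have hb := fun i => (abs_le_fieldNorm (U := U) (B := B) (x := x) i).2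
  have hg := fun i => (abs_le_gradNorm (U := U) (B := B) (x := x) i j).1
  have hg' := fun i => (abs_le_gradNorm (U := U) (B := B) (x := x) i j).2
  have hJ := fun i => h.abs_J_le i x
  have ht := gradNorm_nonneg (U := U) (B := B) (x := x)
  have hs := fieldNorm_nonneg (U := U) (B := B) (x := x)
  set s := fieldNorm U B x
  set t := gradNorm U B x
  have hterm : ∀ i, |-(1 / 2) * (U j x * (U i x * U i x)) + ν * (U i x * pd j (U i) x)
    + B i x * (pd j (B i) x
      - ((J i x * B j x - J j x * B i x) - (U i x * B j x - U j x * B i x)))|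
      ≤ 1 / 2 * (s * (s * s)) + ν * (s * t)
        + s * (t + ((2 * t * s + 2 * t * s) + (s * s + s * s))) := by
    intro i
    refine (abs_add_le _ _).trans (add_le_add ((abs_add_le _ _).trans (add_le_add ?_ ?_)) ?_)
    · exact abs_mul_le_mul (by norm_num) (abs_mul_le_mul (hu j) (abs_mul_le_mul (hu i) (hu i)))
    · exact abs_mul_le_mul (abs_of_pos hν).le (abs_mul_le_mul (hu i) (hg i))
    · refine abs_mul_le_mul (hb i) ((abs_sub _ _).trans (add_le_add (hg' i)
        ((abs_sub _ _).trans (add_le_add ((abs_sub _ _).trans (add_le_add ?_ ?_))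
          ((abs_sub _ _).trans (add_le_add ?_ ?_))))))
      exacts [abs_mul_le_mul (hJ i) (hb j), abs_mul_le_mul (hJ j) (hb i),
        abs_mul_le_mul (hu i) (hb j), abs_mul_le_mul (hu j) (hb i)]
  unfold flux
  refine (Finset.abs_sum_le_sum_abs _ _).trans ((Finset.sum_le_sum fun i _ => hterm i).trans ?_)
  simp only [Finset.sum_const, Finset.card_univ, Fintype.card_fin, nsmul_eq_mul]
  push_cast
  have a1 : 0 ≤ s * (s * s) := by positivity
  have a2 : 0 ≤ s * t := by positivity
  have a3 : 0 ≤ s * s * t := by positivity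
  nlinarith [mul_nonneg hν.le a1, mul_nonneg hν.le a2, mul_nonneg hν.le a3]

/-- The local energy inequality, with all boundary terms estimated by local integral norms. -/
theorem setIntegral_energy_le (hν : 0 < ν) (hgrad : Integrable fun x => gradNorm U B x ^ 2) :
    ∃ M, 0 ≤ M ∧ ∀ R, 0 < R → ∀ X Y X' Y' D : ℝ,
      X = √(∫ x in annulus R, fieldNorm U B x ^ 2) →
      Y = √(∫ x in annulus R, (fieldNorm U B x ^ 2) ^ 2) →
      X' = √(∫ x in Metric.closedBall 0 (4 * R), fieldNorm U B x ^ 2) →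
      Y' = √(∫ x in Metric.closedBall 0 (4 * R), (fieldNorm U B x ^ 2) ^ 2) →
      D = √(∫ x, gradNorm U B x ^ 2) →
      ∫ x in Metric.closedBall 0 R,
        (ν * (∑ i, ∑ j, pd j (U i) x ^ 2) + ∑ i, ∑ j, pd j (B i) x ^ 2)
      ≤ M / R * ((X * Y + X * D + Y * D) + ((Y' + D) * X + (Y + D) * X')) := by
  obtain ⟨C, hC, hcut⟩ := exists_isCutoff
  -- Here 36 = 3 · 12 sums the three flux components, and 72 = 9 · 8 sums the nine stress components
  -- in the pressure estimate.
  refine ⟨36 * C * (1 + ν) + 60 * C ^ 2 * (72 * (1 + ν)), by positivity, ?_⟩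
  intro R hR X Y X' Y' D hX hY hX' hY' hD
  obtain ⟨σ, hσ⟩ := hcut R hR
  obtain ⟨χ, hχ⟩ := hcut (2 * R) (by positivity)
  have hC0 : 0 < C := by linarith
  have hsC := h.continuous_fieldNorm
  have htC := h.continuous_gradNorm
  set s := fieldNorm U B with hs
  set t := gradNorm U B with ht
  have hX0 : 0 ≤ X := hX ▸ Real.sqrt_nonneg _
  have hY0 : 0 ≤ Y := hY ▸ Real.sqrt_nonneg _
  have hX'0 : 0 ≤ X' := hX' ▸ Real.sqrt_nonneg _
  have hY'0 : 0 ≤ Y' := hY' ▸ Real.sqrt_nonneg _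
  have hD0 : 0 ≤ D := hD ▸ Real.sqrt_nonneg _
  have hA := isCompact_annulus R
  have hbc : IsCompact (Metric.closedBall (0 : E3) (4 * R)) := isCompact_closedBall _ _
  have hDS : ∀ S : Set E3, √(∫ x in S, t x ^ 2) ≤ D := fun S => by
    rw [hD]
    exact Real.sqrt_le_sqrt (setIntegral_le_integral hgrad
      (Filter.Eventually.of_forall fun x => sq_nonneg _))
  -- the pressure term
  have hpr := abs_integral_cutoff_mul_le hR hC hσ hχ h.contDiff_U h.div_U h.contDiff_stress
    h.differentiable_p h.pd_p
  have hUX : ∀ S : Set E3, IsCompact S → √(∫ x in S, ∑ k, U k x ^ 2) ≤ √(∫ x in S, s x ^ 2) := by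
    intro S hS
    refine Real.sqrt_le_sqrt (setIntegral_mono (Continuous.continuousOn (by
      have := fun i => (h.contDiff_U i).continuous
      fun_prop) |>.integrableOn_compact hS) ((hsC.pow 2).continuousOn.integrableOn_compact hS)
      fun x => ?_)
    simp only [hs, fieldNorm_sq]
    exact Finset.sum_le_sum fun k _ => by nlinarith [sq_nonneg (B k x)]
  have hTS : ∀ S : Set E3, IsCompact S → ∀ i j, √(∫ x in S, stress ν U B i j x ^ 2)
      ≤ 8 * (1 + ν) * (√(∫ x in S, (s x ^ 2) ^ 2) + D) := by
    intro S hS i j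
    have hTc := (h.contDiff_stress i j).continuous
    have i1 : IntegrableOn (fun x => (s x ^ 2) ^ 2) S :=
      ((hsC.pow 2).pow 2).continuousOn.integrableOn_compact hS
    have i2 : IntegrableOn (fun x => t x ^ 2) S := (htC.pow 2).continuousOn.integrableOn_compact hS
    have e1 : ∫ x in S, stress ν U B i j x ^ 2
        ≤ 2 * (4 * (1 + ν)) ^ 2 * ((∫ x in S, (s x ^ 2) ^ 2) + ∫ x in S, t x ^ 2) := by
      rw [← integral_add i1 i2, ← integral_const_mul]
      refine setIntegral_mono ((hTc.pow 2).continuousOn.integrableOn_compact hS)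
        ((i1.add i2).const_mul _) fun x => ?_
      have := pow_le_pow_left₀ (abs_nonneg _) (abs_stress_le (U := U) (B := B) hν i j x) 2
      rw [sq_abs] at this
      refine this.trans ?_
      rw [mul_pow, mul_comm (2 : ℝ), mul_assoc]
      refine mul_le_mul_of_nonneg_left ?_ (sq_nonneg _)
      simp only [← hs, ← ht]
      nlinarith [sq_nonneg (s x ^ 2 - t x)]
    have n1 : 0 ≤ ∫ x in S, (s x ^ 2) ^ 2 := integral_nonneg fun x => by positivity
    have n2 : 0 ≤ ∫ x in S, t x ^ 2 := integral_nonneg fun x => by positivity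
    refine le_trans ?_ (mul_le_mul_of_nonneg_left (add_le_add_right (hDS S) _) (by positivity))
    rw [Real.sqrt_le_left (by positivity)]
    refine e1.trans ?_
    have r1 := Real.sq_sqrt n1
    have r2 := Real.sq_sqrt n2
    set a := √(∫ x in S, (s x ^ 2) ^ 2)
    set b := √(∫ x in S, t x ^ 2)
    have ha : 0 ≤ a := Real.sqrt_nonneg _
    have hb : 0 ≤ b := Real.sqrt_nonneg _
    rw [← r1, ← r2]
    have : (8 * (1 + ν) * (a + b)) ^ 2 - 2 * (4 * (1 + ν)) ^ 2 * (a ^ 2 + b ^ 2)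
      = (1 + ν) ^ 2 * (32 * (a ^ 2 + b ^ 2) + 128 * (a * b)) := by ring
    have : 0 ≤ (1 + ν) ^ 2 * (32 * (a ^ 2 + b ^ 2) + 128 * (a * b)) := by positivity
    linarith
  have hP : |∫ x, σ x * ∑ i, U i x * ∑ j, pd j (stress ν U B i j) x|
      ≤ 60 * C ^ 2 * (72 * (1 + ν)) / R * ((Y' + D) * X + (Y + D) * X') := by
    refine hpr.trans ?_
    have hsum : ∀ i j : Fin 3, (√(∫ x in Metric.closedBall 0 (4 * R), stress ν U B i j x ^ 2)
            * √(∫ x in annulus R, ∑ k, U k x ^ 2)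
          + √(∫ x in annulus R, stress ν U B i j x ^ 2)
            * √(∫ x in Metric.closedBall 0 (4 * R), ∑ k, U k x ^ 2))
        ≤ 8 * (1 + ν) * ((Y' + D) * X + (Y + D) * X') := by
      intro i j
      have q1 := mul_le_mul (hTS _ hbc i j) (hUX _ hA) (Real.sqrt_nonneg _)
        (by rw [← hY']; positivity)
      have q2 := mul_le_mul (hTS _ hA i j) (hUX _ hbc) (Real.sqrt_nonneg _)
        (by rw [← hY]; positivity)
      rw [← hX, ← hY'] at q1
      rw [← hX', ← hY] at q2
      linarith
    refine (mul_le_mul_of_nonneg_left (Finset.sum_le_sum fun i _ => Finset.sum_le_sum fun j _ =>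
      hsum i j) (by positivity)).trans_eq ?_
    simp only [Finset.sum_const, Finset.card_univ, Fintype.card_fin, nsmul_eq_mul]
    push_cast; ring
  -- the flux term
  have hFc := fun j => (h.contDiff_flux j).continuous
  have hpσc : ∀ j, Continuous (pd j σ) := fun j =>
    (hσ.contDiff.of_le (show (1 : WithTop ℕ∞) ≤ 3 by norm_num)).continuous_pd j
  have hF : ∀ j, |∫ x, flux ν U B J j x * pd j σ x|
      ≤ 12 * C * (1 + ν) / R * (X * Y + X * D + Y * D) := by
    intro j
    have hcs : ∀ {a b : E3 → ℝ}, Continuous a → Continuous b →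
        ∫ x in annulus R, a x * b x
          ≤ √(∫ x in annulus R, a x ^ 2) * √(∫ x in annulus R, b x ^ 2) := fun ha hb =>
      (le_abs_self _).trans (abs_integral_mul_le_sqrt_mul_sqrt (ha.memLp_two_restrict hA)
        (hb.memLp_two_restrict hA))
    have c1 := hcs hsC (hsC.pow 2)
    have c2 := (hcs hsC htC).trans (mul_le_mul_of_nonneg_left (hDS _) (Real.sqrt_nonneg _))
    have c3 := (hcs (hsC.pow 2) htC).trans (mul_le_mul_of_nonneg_left (hDS _) (Real.sqrt_nonneg _))
    rw [← hX] at c1 c2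
    simp only [Pi.pow_apply] at c1 c3
    rw [← hY] at c1 c3
    have i1 : IntegrableOn (fun x => s x * s x ^ 2) (annulus R) :=
      (hsC.mul (hsC.pow 2)).continuousOn.integrableOn_compact hA
    have i2 : IntegrableOn (fun x => s x * t x) (annulus R) :=
      (hsC.mul htC).continuousOn.integrableOn_compact hA
    have i3 : IntegrableOn (fun x => s x ^ 2 * t x) (annulus R) :=
      ((hsC.pow 2).mul htC).continuousOn.integrableOn_compact hA
    have i12 : IntegrableOn (fun x => s x * s x ^ 2 + s x * t x) (annulus R) := i1.add i2
    have i123 : IntegrableOn (fun x => s x * s x ^ 2 + s x * t x + s x ^ 2 * t x) (annulus R) :=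
      i12.add i3
    rw [← setIntegral_eq_integral_of_forall_compl_eq_zero (s := annulus R) fun x hx => by
      rw [hσ.pd_eq_zero_of_notMem j le_rfl (by linarith) hx, mul_zero]]
    calc |∫ x in annulus R, flux ν U B J j x * pd j σ x|
        ≤ ∫ x in annulus R, |flux ν U B J j x * pd j σ x| := abs_integral_le_integral_abs
      _ ≤ ∫ x in annulus R, 12 * (1 + ν) * (C / R)
            * (s x * s x ^ 2 + s x * t x + s x ^ 2 * t x) := by
          refine setIntegral_mono (((hFc j).mul (hpσc j)).abs.continuousOn.integrableOn_compact hA)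
            (i123.const_mul _) fun x => ?_
          refine (abs_mul_le_mul (h.abs_flux_le hν j x) (hσ.abs_pd_le j x)).trans_eq ?_
          ring
      _ = 12 * (1 + ν) * (C / R) * ((∫ x in annulus R, s x * s x ^ 2)
            + (∫ x in annulus R, s x * t x) + ∫ x in annulus R, s x ^ 2 * t x) := by
          rw [integral_const_mul, integral_add i12 i3, integral_add i1 i2]
      _ ≤ 12 * (1 + ν) * (C / R) * (X * Y + X * D + Y * D) :=
          mul_le_mul_of_nonneg_left (add_le_add (add_le_add c1 c2) c3) (by positivity)
      _ = _ := by ring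
  -- the energy balance
  set e : E3 → ℝ := fun x => ν * (∑ i, ∑ j, pd j (U i) x ^ 2) + ∑ i, ∑ j, pd j (B i) x ^ 2 with he
  have hpU : ∀ i j, Continuous (pd j (U i)) := fun i j => ((h.contDiff_U i).pd_one j).continuous
  have hpB : ∀ i j, Continuous (pd j (B i)) := fun i j => ((h.contDiff_B i).pd_one j).continuous
  have hec : Continuous e := by fun_prop
  have he0 : ∀ x, 0 ≤ e x := fun x => by
    simp only [he]
    have : ∀ V : Fin 3 → E3 → ℝ, 0 ≤ ∑ i, ∑ j, pd j (V i) x ^ 2 := fun V =>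
      Finset.sum_nonneg fun i _ => Finset.sum_nonneg fun j _ => sq_nonneg _
    have hU := this U
    have hB := this B
    positivity
  have hσc := hσ.contDiff.continuous
  have hσs := hσ.hasCompactSupport
  have hpF : ∀ j, Continuous (pd j (flux ν U B J j)) := fun j => (h.contDiff_flux j).continuous_pd j
  have hpT : ∀ i j, Continuous (pd j (stress ν U B i j)) := fun i j =>
    (h.contDiff_stress i j).continuous_pd j
  have hUc := fun i => (h.contDiff_U i).continuous
  have iσe : Integrable fun x => σ x * e x :=
    (hσc.mul hec).integrable_of_hasCompactSupport hσs.mul_right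
  have iσG : Integrable fun x => σ x * ∑ i, U i x * ∑ j, pd j (stress ν U B i j) x :=
    Continuous.integrable_of_hasCompactSupport (by fun_prop) hσs.mul_right
  have iσF : ∀ j, Integrable fun x => pd j (flux ν U B J j) x * σ x := fun j =>
    ((hpF j).mul hσc).integrable_of_hasCompactSupport hσs.mul_left
  have hbal : ∫ x, σ x * e x = (∫ x, σ x * ∑ i, U i x * ∑ j, pd j (stress ν U B i j) x)
      - ∑ j, ∫ x, flux ν U B J j x * pd j σ x := by
    have hibp : ∀ j, ∫ x, flux ν U B J j x * pd j σ x
        = - ∫ x, pd j (flux ν U B J j) x * σ x := fun j =>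
      integral_mul_pd j ((h.contDiff_flux j).differentiable one_ne_zero) (hpF j)
        (hσ.contDiff.of_le (by norm_num)) hσs
    simp only [hibp, Finset.sum_neg_distrib, sub_neg_eq_add]
    rw [← integral_finsetSum _ fun j _ => iσF j, ← integral_add iσG
      (integrable_finsetSum _ fun j _ => iσF j)]
    refine integral_congr_ae (Filter.Eventually.of_forall fun x => ?_)
    simp only [← Finset.sum_mul, h.sum_pd_flux x, he]
    ring
  -- The energy density is nonnegative and σ = 1 on the inner ball.
  have hlow : ∫ x in Metric.closedBall 0 R, e x ≤ ∫ x, σ x * e x := by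
    refine le_trans (le_of_eq ?_) (setIntegral_le_integral (s := Metric.closedBall 0 R) iσe
      (Filter.Eventually.of_forall fun x => mul_nonneg (hσ.nonneg x) (he0 x)))
    refine setIntegral_congr_fun measurableSet_closedBall fun x hx => ?_
    simp only [hσ.eq_one x (mem_closedBall_zero_iff.1 hx), one_mul]
  have hFsum : |∑ j, ∫ x, flux ν U B J j x * pd j σ x|
      ≤ 36 * C * (1 + ν) / R * (X * Y + X * D + Y * D) := by
    refine (Finset.abs_sum_le_sum_abs _ _).trans ((Finset.sum_le_sum fun j _ => hF j).trans_eq ?_)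
    simp only [Finset.sum_const, Finset.card_univ, Fintype.card_fin, nsmul_eq_mul]
    push_cast; ring
  have z1 : 0 ≤ X * Y + X * D + Y * D := by positivity
  have z2 : 0 ≤ (Y' + D) * X + (Y + D) * X' := by positivity
  have z3 : 0 ≤ 36 * C * (1 + ν) / R := by positivity
  have z4 : 0 ≤ 60 * C ^ 2 * (72 * (1 + ν)) / R := by positivity
  rw [hbal] at hlow
  have k1 := le_abs_self (∫ x, σ x * ∑ i, U i x * ∑ j, pd j (stress ν U B i j) x)
  have k2 := neg_abs_le (∑ j, ∫ x, flux ν U B J j x * pd j σ x)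
  rw [add_div]
  nlinarith [mul_nonneg z3 z2, mul_nonneg z4 z1]

end HallComponents

/-! ### Exponent count and passage to the limit. -/

/-- Hölder's inequality on bounded subsets of a ball, for the exponent `9/2`. -/
theorem exists_sqrt_setIntegral_le : ∃ c : ℝ, 0 ≤ c ∧ ∀ (s : E3 → ℝ) (R : ℝ) (S : Set E3),
    Continuous s → (∀ x, 0 ≤ s x) → 0 < R → IsCompact S → S ⊆ Metric.closedBall 0 (4 * R) →
    √(∫ x in S, s x ^ 2) ≤ c * (∫ x in S, s x ^ (9 / 2 : ℝ)) ^ (2 / 9 : ℝ) * R ^ (5 / 6 : ℝ) ∧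
    √(∫ x in S, (s x ^ 2) ^ 2)
      ≤ c * (∫ x in S, s x ^ (9 / 2 : ℝ)) ^ (4 / 9 : ℝ) * R ^ (1 / 6 : ℝ) := by
  -- 64 = 4³ is the volume factor of the ball of radius 4R. The Hölder pairs below are (9/4, 9/5)
  -- for s² and (9/8, 9) for s⁴.
  set c0 : ℝ := 64 * volume.real (Metric.ball (0 : E3) 1) with hc0
  have hc0n : 0 ≤ c0 := by positivity
  refine ⟨c0 ^ (5 / 18 : ℝ) + c0 ^ (1 / 18 : ℝ), by positivity, ?_⟩
  intro s R S hs hs0 hR hS hSb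
  set Q := ∫ x in S, s x ^ (9 / 2 : ℝ) with hQ
  have hQ0 : 0 ≤ Q := integral_nonneg fun x => Real.rpow_nonneg (hs0 x) _
  have hvol : volume.real S ≤ c0 * R ^ 3 := by
    refine (measureReal_mono hSb (isCompact_closedBall _ _).measure_lt_top.ne).trans_eq ?_
    rw [Measure.addHaar_real_closedBall _ _ (by positivity), finrank_euclideanSpace_fin, hc0]
    ring
  have : IsFiniteMeasure (volume.restrict S) := ⟨by
    rw [Measure.restrict_apply_univ]; exact hS.measure_lt_top⟩
  have key : ∀ (f : E3 → ℝ) (p q : ℝ), Continuous f → (∀ x, 0 ≤ f x) → p.HolderConjugate q →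
      ∫ x in S, f x ≤ (∫ x in S, f x ^ p) ^ (1 / p) * (c0 * R ^ 3) ^ (1 / q) := by
    intro f p q hf hf0 hpq
    obtain ⟨M, hM⟩ := hS.exists_bound_of_continuousOn hf.continuousOn
    have hfL : MemLp f (ENNReal.ofReal p) (volume.restrict S) :=
      MemLp.of_bound hf.aestronglyMeasurable M
        ((ae_restrict_iff' hS.measurableSet).2 (Filter.Eventually.of_forall hM))
    have h := integral_mul_le_Lp_mul_Lq_of_nonneg (μ := volume.restrict S) hpq
      (Filter.Eventually.of_forall hf0) (g := fun _ => 1)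
      (Filter.Eventually.of_forall fun _ => zero_le_one) hfL (memLp_const 1)
    simp only [mul_one, Real.one_rpow, integral_const, smul_eq_mul, measureReal_restrict_apply,
      MeasurableSet.univ, Set.univ_inter] at h
    refine h.trans (mul_le_mul_of_nonneg_left ?_ (Real.rpow_nonneg
      (integral_nonneg fun x => Real.rpow_nonneg (hf0 x) _) _))
    exact Real.rpow_le_rpow measureReal_nonneg hvol (one_div_nonneg.2 hpq.symm.nonneg)
  have hpow : ∀ x, ∀ n : ℕ, ∀ a : ℝ, (n : ℝ) * a = 9 / 2 → (s x ^ n) ^ a = s x ^ (9 / 2 : ℝ) := by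
    intro x n a ha
    rw [← Real.rpow_natCast, ← Real.rpow_mul (hs0 x), ha]
  have hsplit : ∀ a b d : ℝ, √(Q ^ a * (c0 * R ^ 3) ^ b) ≤ d * Q ^ (a / 2) * R ^ (3 * b / 2) ↔
      c0 ^ (b / 2) * Q ^ (a / 2) * R ^ (3 * b / 2) ≤ d * Q ^ (a / 2) * R ^ (3 * b / 2) := by
    intro a b d
    have e : √(Q ^ a * (c0 * R ^ 3) ^ b) = c0 ^ (b / 2) * Q ^ (a / 2) * R ^ (3 * b / 2) := by
      rw [Real.sqrt_eq_rpow, Real.mul_rpow (by positivity) (by positivity), ← Real.rpow_mul hQ0,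
        ← Real.rpow_mul (by positivity), Real.mul_rpow hc0n (by positivity), ← Real.rpow_natCast,
        ← Real.rpow_mul hR.le]
      rw [show ((3 : ℕ) : ℝ) * (b * (1 / 2)) = 3 * b / 2 by push_cast; ring, mul_one_div,
        mul_one_div]
      ring
    rw [e]
  constructor
  · have h := key (fun x => s x ^ 2) (9 / 4) (9 / 5) (hs.pow 2) (fun x => sq_nonneg _)
      ⟨by norm_num, by norm_num, by norm_num⟩
    simp only [hpow _ 2 (9 / 4) (by norm_num), ← hQ] at h
    refine (Real.sqrt_le_sqrt h).trans ?_
    have h2 := hsplit (1 / (9 / 4)) (1 / (9 / 5)) (c0 ^ (5 / 18 : ℝ) + c0 ^ (1 / 18 : ℝ))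
    norm_num at h2 ⊢
    rw [h2]
    gcongr
    exact le_add_of_nonneg_right (by positivity)
  · have h := key (fun x => (s x ^ 2) ^ 2) (9 / 8) 9 ((hs.pow 2).pow 2) (fun x => sq_nonneg _)
      ⟨by norm_num, by norm_num, by norm_num⟩
    simp only [← pow_mul, hpow _ (2 * 2) (9 / 8) (by norm_num), ← hQ] at h
    simp only [← pow_mul]
    refine (Real.sqrt_le_sqrt h).trans ?_
    have h2 := hsplit (1 / (9 / 8)) (1 / 9) (c0 ^ (5 / 18 : ℝ) + c0 ^ (1 / 18 : ℝ))
    norm_num at h2 ⊢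
    rw [h2]
    gcongr
    exact le_add_of_nonneg_left (by positivity)

/-- The integral of an integrable function over the annuli of radii `n` and `4n` tends to zero. -/
theorem tendsto_setIntegral_annulus {f : E3 → ℝ} (hf : Integrable f) :
    Filter.Tendsto (fun n : ℕ => ∫ x in annulus n, f x) Filter.atTop (nhds 0) := by
  simp only [← integral_indicator (isClosed_annulus _).measurableSet]
  rw [← integral_zero E3 ℝ]
  refine tendsto_integral_of_dominated_convergence (fun x => ‖f x‖) (fun n =>
    (hf.indicator (isClosed_annulus _).measurableSet).aestronglyMeasurable) hf.norm (fun n =>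
    Filter.Eventually.of_forall fun x => norm_indicator_le_norm_self _ _)
    (Filter.Eventually.of_forall fun x => ?_)
  -- Each point eventually lies inside the inner radius, so the indicators vanish eventually.
  refine tendsto_const_nhds.congr' ?_
  obtain ⟨N, hN⟩ := exists_nat_gt ‖x‖
  filter_upwards [Filter.eventually_ge_atTop N] with n hn
  have : x ∉ annulus n := fun hx => by
    have h1 : (N : ℝ) ≤ n := by exact_mod_cast hn
    exact absurd hx.1 (by linarith)
  rw [Set.indicator_of_notMem this]

/-- With ρ = R^(1/6) all powers become integral. The coefficients a, b belong to the annulus and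
will tend to 0, so for them powers up to ρ⁶ are allowed. In D X' neither factor need be small, so
the gain ρ⁻¹ has to be kept. -/
theorem boundary_terms_le {M R ρ X Y X' Y' D a b a' b' : ℝ} (hM : 0 ≤ M) (hρ : 1 ≤ ρ)
    (hR : R = ρ ^ 6) (hX0 : 0 ≤ X) (hY0 : 0 ≤ Y) (hX'0 : 0 ≤ X') (hY'0 : 0 ≤ Y') (hD : 0 ≤ D)
    (hX : X ≤ a * ρ ^ 5) (hY : Y ≤ b * ρ) (hX' : X' ≤ a' * ρ ^ 5) (hY' : Y' ≤ b' * ρ) :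
    M / R * ((X * Y + X * D + Y * D) + ((Y' + D) * X + (Y + D) * X'))
      ≤ M * (a * b + a * D + b * D + (b' + D) * a + b * a' + D * a' * ρ⁻¹) := by
  have hρ0 : 0 < ρ := by linarith
  have nn : ∀ {x y z : ℝ}, 0 ≤ x → x ≤ y * z → 0 < z → 0 ≤ y := fun h0 h1 hz => by
    by_contra hy
    nlinarith
  have ha := nn hX0 hX (by positivity)
  have hb := nn hY0 hY hρ0
  have ha' := nn hX'0 hX' (by positivity)
  have hb' := nn hY'0 hY' hρ0
  have p56 : ρ ^ 5 ≤ ρ ^ 6 := pow_le_pow_right₀ hρ (by norm_num)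
  have p16 : ρ ≤ ρ ^ 6 := by simpa using pow_le_pow_right₀ hρ (show 1 ≤ 6 by norm_num)
  have t1 : X * Y ≤ a * b * ρ ^ 6 :=
    (mul_le_mul hX hY hY0 (by positivity)).trans_eq (by ring)
  have t2 : X * D ≤ a * D * ρ ^ 6 := by
    calc X * D ≤ a * ρ ^ 5 * D := mul_le_mul_of_nonneg_right hX hD
      _ = a * D * ρ ^ 5 := by ring
      _ ≤ _ := by gcongr
  have t3 : Y * D ≤ b * D * ρ ^ 6 := by
    calc Y * D ≤ b * ρ * D := mul_le_mul_of_nonneg_right hY hD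
      _ = b * D * ρ := by ring
      _ ≤ _ := by gcongr
  have t4 : Y' * X ≤ b' * a * ρ ^ 6 :=
    (mul_le_mul hY' hX hX0 (by positivity)).trans_eq (by ring)
  have t5 : Y * X' ≤ b * a' * ρ ^ 6 :=
    (mul_le_mul hY hX' hX'0 (by positivity)).trans_eq (by ring)
  have t6 : D * X' ≤ D * a' * ρ⁻¹ * ρ ^ 6 := by
    refine (mul_le_mul_of_nonneg_left hX' hD).trans_eq ?_
    field_simp
  rw [div_mul_eq_mul_div, mul_div_assoc]
  refine mul_le_mul_of_nonneg_left ?_ hM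
  rw [div_le_iff₀ (by rw [hR]; positivity), hR]
  nlinarith

namespace HallComponents

variable {ν : ℝ} {U B J : Fin 3 → E3 → ℝ} {p : E3 → ℝ} (h : HallComponents ν U B J p)

include h

/-- The Liouville property of the system in components: the gradients vanish. -/
theorem gradient_eq_zero (hν : 0 < ν) (hgrad : Integrable fun x => gradNorm U B x ^ 2)
    (hint : Integrable fun x => fieldNorm U B x ^ (9 / 2 : ℝ)) (i j : Fin 3) (x : E3) :
    pd j (U i) x = 0 ∧ pd j (B i) x = 0 := by
  obtain ⟨M, hM, hE⟩ := h.setIntegral_energy_le hν hgrad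
  obtain ⟨c, hc, hH⟩ := exists_sqrt_setIntegral_le
  have hsC := h.continuous_fieldNorm
  set s := fieldNorm U B with hs
  have hs0 : ∀ x, 0 ≤ s x := fun x => fieldNorm_nonneg
  have hsp : ∀ x, 0 ≤ s x ^ (9 / 2 : ℝ) := fun x => Real.rpow_nonneg (hs0 x) _
  set D := √(∫ x, gradNorm U B x ^ 2) with hD
  set Q := ∫ x, s x ^ (9 / 2 : ℝ) with hQ
  set q : ℕ → ℝ := fun n => ∫ x in annulus n, s x ^ (9 / 2 : ℝ) with hq
  have hq0 : Filter.Tendsto q Filter.atTop (nhds 0) := tendsto_setIntegral_annulus hint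
  set e : E3 → ℝ := fun x => ν * (∑ i, ∑ j, pd j (U i) x ^ 2) + ∑ i, ∑ j, pd j (B i) x ^ 2 with he
  have hpU : ∀ i j, Continuous (pd j (U i)) := fun i j => ((h.contDiff_U i).pd_one j).continuous
  have hpB : ∀ i j, Continuous (pd j (B i)) := fun i j => ((h.contDiff_B i).pd_one j).continuous
  have hec : Continuous e := by fun_prop
  have hV0 : ∀ (V : Fin 3 → E3 → ℝ) x, 0 ≤ ∑ i, ∑ j, pd j (V i) x ^ 2 := fun V x =>
    Finset.sum_nonneg fun i _ => Finset.sum_nonneg fun j _ => sq_nonneg _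
  have he0 : ∀ x, 0 ≤ e x := fun x => add_nonneg (mul_nonneg hν.le (hV0 U x)) (hV0 B x)
  have hei : Integrable e := by
    refine (hgrad.const_mul (ν + 1)).mono' hec.aestronglyMeasurable
      (Filter.Eventually.of_forall fun x => ?_)
    rw [Real.norm_of_nonneg (he0 x), gradNorm_sq]
    simp only [Finset.sum_add_distrib]
    simp only [he]
    nlinarith [hV0 U x, mul_nonneg hν.le (hV0 B x)]
  -- Every summand carries a positive power of the tail `q n` except the last, which carries the
  -- inverse of n^(1/6).
  set bd : ℕ → ℝ := fun n => M * (c * q n ^ (2 / 9 : ℝ) * (c * q n ^ (4 / 9 : ℝ))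
    + c * q n ^ (2 / 9 : ℝ) * D + c * q n ^ (4 / 9 : ℝ) * D
    + (c * Q ^ (4 / 9 : ℝ) + D) * (c * q n ^ (2 / 9 : ℝ))
    + c * q n ^ (4 / 9 : ℝ) * (c * Q ^ (2 / 9 : ℝ))
    + D * (c * Q ^ (2 / 9 : ℝ)) * ((n : ℝ) ^ (1 / 6 : ℝ))⁻¹) with hbd
  have hbdlim : Filter.Tendsto bd Filter.atTop (nhds 0) := by
    have hr : ∀ a : ℝ, 0 < a → Filter.Tendsto (fun n => c * q n ^ a) Filter.atTop (nhds 0) := by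
      intro a ha
      have := (hq0.rpow_const (p := a) (Or.inr ha.le)).const_mul c
      rwa [Real.zero_rpow ha.ne', mul_zero] at this
    have h2 := hr (2 / 9) (by norm_num)
    have h4 := hr (4 / 9) (by norm_num)
    have hn : Filter.Tendsto (fun n : ℕ => ((n : ℝ) ^ (1 / 6 : ℝ))⁻¹) Filter.atTop (nhds 0) :=
      ((tendsto_rpow_atTop (by norm_num)).comp tendsto_natCast_atTop_atTop).inv_tendsto_atTop
    have := ((((((h2.mul h4).add (h2.mul_const D)).add (h4.mul_const D)).add
      (h2.const_mul (c * Q ^ (4 / 9 : ℝ) + D))).add (h4.mul_const (c * Q ^ (2 / 9 : ℝ)))).add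
      (hn.const_mul (D * (c * Q ^ (2 / 9 : ℝ))))).const_mul M
    simp only [mul_zero, zero_mul, add_zero] at this
    exact this
  have hle : ∀ n : ℕ, 1 ≤ n → ∫ x in Metric.closedBall 0 (n : ℝ), e x ≤ bd n := by
    intro n hn
    have hn1 : (1 : ℝ) ≤ n := by exact_mod_cast hn
    have hn0 : (0 : ℝ) < n := by linarith
    have hA := hH s n (annulus n) hsC hs0 hn0 (isCompact_annulus _) (annulus_subset _)
    have hB := hH s n _ hsC hs0 hn0 (isCompact_closedBall _ _) subset_rfl
    have hQle : ∫ x in Metric.closedBall 0 (4 * (n : ℝ)), s x ^ (9 / 2 : ℝ) ≤ Q :=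
      setIntegral_le_integral hint (Filter.Eventually.of_forall hsp)
    have hQn : 0 ≤ ∫ x in Metric.closedBall 0 (4 * (n : ℝ)), s x ^ (9 / 2 : ℝ) :=
      integral_nonneg hsp
    have r5 : (n : ℝ) ^ (5 / 6 : ℝ) = ((n : ℝ) ^ (1 / 6 : ℝ)) ^ 5 := by
      rw [← Real.rpow_natCast, ← Real.rpow_mul hn0.le]; norm_num
    have r6 : (n : ℝ) = ((n : ℝ) ^ (1 / 6 : ℝ)) ^ 6 := by
      rw [← Real.rpow_natCast, ← Real.rpow_mul hn0.le]; norm_num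
    rw [r5] at hA hB
    refine (hE n hn0 _ _ _ _ _ rfl rfl rfl rfl rfl).trans ?_
    refine boundary_terms_le hM (Real.one_le_rpow hn1 (by norm_num)) r6 (Real.sqrt_nonneg _)
      (Real.sqrt_nonneg _) (Real.sqrt_nonneg _) (Real.sqrt_nonneg _) (Real.sqrt_nonneg _)
      hA.1 hA.2 (hB.1.trans ?_) (hB.2.trans ?_)
    · gcongr
    · gcongr
  have hcov : Filter.Tendsto (fun n : ℕ => ∫ x in Metric.closedBall 0 (n : ℝ), e x) Filter.atTop
      (nhds (∫ x, e x)) :=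
    (aecover_closedBall (μ := volume) (x := (0 : E3))
      tendsto_natCast_atTop_atTop).integral_tendsto_of_countably_generated hei
  have hzero : ∫ x, e x = 0 := le_antisymm
    (le_of_tendsto_of_tendsto hcov hbdlim ((Filter.eventually_ge_atTop 1).mono hle))
    (integral_nonneg he0)
  -- Continuity upgrades almost everywhere vanishing to everywhere.
  have hez : e = 0 := by
    rw [integral_eq_zero_iff_of_nonneg he0 hei] at hzero
    exact (hec.ae_eq_iff_eq volume continuous_zero).1 hzero
  have hx := congrFun hez x
  simp only [he, Pi.zero_apply] at hx
  have hU0 : ∑ i, ∑ j, pd j (U i) x ^ 2 = 0 := by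
    nlinarith [hV0 U x, hV0 B x, mul_nonneg hν.le (hV0 U x)]
  have hB0 : ∑ i, ∑ j, pd j (B i) x ^ 2 = 0 := by rw [hU0] at hx; linarith
  have extract : ∀ V : Fin 3 → E3 → ℝ, ∑ i, ∑ j, pd j (V i) x ^ 2 = 0 → pd j (V i) x = 0 := by
    intro V hV
    rw [Finset.sum_eq_zero_iff_of_nonneg fun i _ =>
      Finset.sum_nonneg fun j _ => sq_nonneg _] at hV
    have h1 := hV i (Finset.mem_univ i)
    rw [Finset.sum_eq_zero_iff_of_nonneg fun j _ => sq_nonneg _] at h1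
    exact pow_eq_zero_iff two_ne_zero |>.1 (h1 j (Finset.mem_univ j))
  exact ⟨extract U hU0, extract B hB0⟩

end HallComponents

/-! ### From vector fields to components, and the conclusion. -/

section Components

variable {v w : E3 → E3} {x : E3}

theorem partialD_eq_pd (hv : DifferentiableAt ℝ v x) (j i : Fin 3) :
    partialD v j i x = pd j (fun y => v y i) x := by
  have h := (EuclideanSpace.proj (𝕜 := ℝ) i : E3 →L[ℝ] ℝ).hasFDerivAt.comp x hv.hasFDerivAt
  have h3 : ((EuclideanSpace.proj (𝕜 := ℝ) i : E3 →L[ℝ] ℝ) ∘ v) = fun y => v y i := rfl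
  rw [pd, ← h3, h.fderiv]
  simp [partialD]

theorem ContDiff.component {n : WithTop ℕ∞} (hv : ContDiff ℝ n v) (i : Fin 3) :
    ContDiff ℝ n fun y => v y i :=
  (EuclideanSpace.proj (𝕜 := ℝ) i : E3 →L[ℝ] ℝ).contDiff.comp hv

theorem gradient_apply {p : E3 → ℝ} (hp : DifferentiableAt ℝ p x) (i : Fin 3) :
    gradient p x i = pd i p x := by
  have h := hp.hasGradientAt.hasFDerivAt.fderiv
  rw [pd, h, InnerProductSpace.toDual_apply_apply, EuclideanSpace.inner_single_right]
  simp

theorem laplacian_apply (hv : ContDiff ℝ 2 v) (i : Fin 3) :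
    (Laplacian.laplacian v x) i = ∑ j, pd j (pd j fun y => v y i) x := by
  rw [InnerProductSpace.laplacian_eq_iteratedFDeriv_orthonormalBasis v
    (EuclideanSpace.basisFun (Fin 3) ℝ)]
  rw [WithLp.ofLp_sum, Finset.sum_apply]
  refine Finset.sum_congr rfl fun j _ => ?_
  have h2 : (pd j fun y => v y i) = fun y => (fderiv ℝ v y (EuclideanSpace.single j 1)) i :=
    funext fun y => (partialD_eq_pd (hv.differentiable two_ne_zero y) j i).symm
  have hd : ContDiff ℝ 1 fun y => fderiv ℝ v y (EuclideanSpace.single j 1) :=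
    (hv.fderiv_right (by norm_num)).clm_apply contDiff_const
  rw [h2, ← partialD_eq_pd (hd.differentiable one_ne_zero x), partialD]
  rw [fderiv_clm_apply ((hv.fderiv_right (m := 1) (by norm_num)).differentiable one_ne_zero x)
    (differentiableAt_const _)]
  simp [iteratedFDeriv_two_apply]

theorem cross_apply_zero (a b : E3) : cross a b 0 = a 1 * b 2 - a 2 * b 1 := by
  simp [cross, crossProduct]

theorem cross_apply_one (a b : E3) : cross a b 1 = a 2 * b 0 - a 0 * b 2 := by
  simp [cross, crossProduct]

theorem cross_apply_two (a b : E3) : cross a b 2 = a 0 * b 1 - a 1 * b 0 := by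
  simp [cross, crossProduct]

theorem ContDiff.cross {n : WithTop ℕ∞} (hv : ContDiff ℝ n v) (hw : ContDiff ℝ n w) :
    ContDiff ℝ n fun y => cross (v y) (w y) := by
  rw [contDiff_euclidean]
  intro i
  have h1 := hv.component
  have h2 := hw.component
  fin_cases i
  · simp only [Fin.zero_eta, cross_apply_zero]; exact ((h1 _).mul (h2 _)).sub ((h1 _).mul (h2 _))
  · simp only [Fin.mk_one, cross_apply_one]; exact ((h1 _).mul (h2 _)).sub ((h1 _).mul (h2 _))
  · simp only [Fin.reduceFinMk, cross_apply_two]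
    exact ((h1 _).mul (h2 _)).sub ((h1 _).mul (h2 _))

/-- The curl of a cross product in divergence form. -/
theorem curl_cross_apply (hv : ContDiff ℝ 1 v) (hw : ContDiff ℝ 1 w) (i : Fin 3) :
    curl (fun y => cross (v y) (w y)) x i
      = ∑ j, pd j (fun y => v y i * w y j - v y j * w y i) x := by
  have hd := ((hv.cross hw).differentiable one_ne_zero x)
  have h0 : ∀ j, pd j (fun _ : E3 => (0 : ℝ)) x = 0 := fun j => by simp [pd]
  have hneg : ∀ a b j, pd j (fun y => v y a * w y b - v y b * w y a) x
      = - pd j (fun y => v y b * w y a - v y a * w y b) x := fun a b j => by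
    rw [← pd_neg]; congr 1; funext y; ring
  fin_cases i <;> simp [curl, partialD_eq_pd hd, cross_apply_zero, cross_apply_one,
    cross_apply_two, Fin.sum_univ_three, h0]
  · rw [hneg 2 0]; ring
  · rw [hneg 0 1]; ring
  · rw [hneg 1 2]; ring

theorem ContDiff.curl (hv : ContDiff ℝ 2 v) : ContDiff ℝ 1 (curl v) := by
  rw [contDiff_euclidean]
  have h : ∀ j i, ContDiff ℝ 1 (partialD v j i) := fun j i => by
    have : partialD v j i = pd j fun y => v y i :=
      funext fun x => partialD_eq_pd (hv.differentiable two_ne_zero x) j i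
    rw [this]; exact (hv.component i).pd_one j
  intro i
  fin_cases i
  · exact (h 1 2).sub (h 2 1)
  · exact (h 2 0).sub (h 0 2)
  · exact (h 0 1).sub (h 1 0)

end Components

theorem IsStationaryHallMHDSolution.hallComponents {ν : ℝ} {u B : E3 → E3}
    (h : IsStationaryHallMHDSolution ν u B) : ∃ p, HallComponents ν (fun i x => u x i)
      (fun i x => B x i) (fun i x => curl B x i) p := by
  obtain ⟨p, hp, hm⟩ := h.momentum
  have hu := h.contDiff_u
  have hB := h.contDiff_B
  have du := hu.differentiable two_ne_zero
  have dB := hB.differentiable two_ne_zero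
  refine ⟨p, ⟨hu.component, hB.component, hp, ?_, ?_, ?_, fun i x => ?_, fun x => ?_,
    fun x => ?_, fun i x => ?_⟩⟩
  · funext x; simp [curl, partialD_eq_pd (dB x)]
  · funext x; simp [curl, partialD_eq_pd (dB x)]
  · funext x; simp [curl, partialD_eq_pd (dB x)]
  · have hx := congrArg (fun z : E3 => z i) (hm x)
    have hc : (convection u u x) i = ∑ j, u x j * pd j (fun y => u y i) x := by
      simp only [convection, WithLp.ofLp_sum, Finset.sum_apply, ← partialD_eq_pd (du x)]
      rfl
    simp only [PiLp.add_apply, PiLp.smul_apply, smul_eq_mul, gradient_apply (hp x),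
      laplacian_apply hu, hc] at hx
    rw [hx]
    congr 1
    fin_cases i <;> simp [cross_apply_zero, cross_apply_one, cross_apply_two, curl,
      partialD_eq_pd (dB x), Fin.sum_univ_three] <;> ring
  · have := h.div_u x
    simpa only [divergence, partialD_eq_pd (du x)] using this
  · have := h.div_B x
    simpa only [divergence, partialD_eq_pd (dB x)] using this
  · have hx := congrArg (fun z : E3 => z i) (h.induction_eq x)
    have hu1 := hu.of_le (show (1 : WithTop ℕ∞) ≤ 2 by norm_num)
    have hB1 := hB.of_le (show (1 : WithTop ℕ∞) ≤ 2 by norm_num)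
    simp only [PiLp.add_apply, PiLp.neg_apply, laplacian_apply hB, curl_cross_apply hu1 hB1,
      curl_cross_apply hB.curl hB1] at hx
    rw [← hx, neg_add_eq_sub, ← Finset.sum_sub_distrib]
    refine Finset.sum_congr rfl fun j _ => ?_
    have cu := fun i => (hu1.component i).differentiable one_ne_zero x
    have cB := fun i => (hB1.component i).differentiable one_ne_zero x
    have cJ := fun i => (hB.curl.component i).differentiable one_ne_zero x
    exact pd_sub j (((cJ i).fun_mul (cB j)).fun_sub ((cJ j).fun_mul (cB i)))
      (((cu i).fun_mul (cB j)).fun_sub ((cu j).fun_mul (cB i)))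

/-- The field is constant, and the whole space has infinite measure. -/
theorem eq_zero_of_partialD_eq_zero {v : E3 → E3} (hv : Differentiable ℝ v)
    (h0 : ∀ i j x, partialD v j i x = 0) (hL : MemLp v (9 / 2 : ℝ≥0∞) volume) : v = 0 := by
  have hf : ∀ x, fderiv ℝ v x = 0 := by
    intro x
    refine ContinuousLinearMap.coe_injective
      ((EuclideanSpace.basisFun (Fin 3) ℝ).toBasis.ext fun j => ?_)
    ext i
    simpa [partialD] using h0 i j x
  have hc : v = fun _ => v 0 := funext fun x => is_const_of_fderiv_eq_zero hv hf x 0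
  rw [hc] at hL
  have h92 : (9 / 2 : ℝ≥0∞) ≠ ⊤ := ENNReal.div_ne_top (by norm_num) (by norm_num)
  have h90 : (9 / 2 : ℝ≥0∞) ≠ 0 := (ENNReal.div_pos (by norm_num) (by norm_num)).ne'
  rw [memLp_const_iff h90 h92] at hL
  rcases hL with hL | hL
  · rw [hc, hL]; rfl
  · simp at hL

theorem theorem2p5 (ν : ℝ) (hν : 0 < ν) (u B : E3 → E3)
    (hsol : IsStationaryHallMHDSolution ν u B)
    (hgrad_u : Integrable (gradNormSq u) volume)
    (hgrad_B : Integrable (gradNormSq B) volume)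
    (hu_bdd : MemLp u ∞ volume) (hB_bdd : MemLp B ∞ volume)
    (hu_int : MemLp u (9 / 2 : ℝ≥0∞) volume) (hB_int : MemLp B (9 / 2 : ℝ≥0∞) volume) :
    u = 0 ∧ B = 0 := by
  obtain ⟨p, h⟩ := hsol.hallComponents
  have du := hsol.contDiff_u.differentiable two_ne_zero
  have dB := hsol.contDiff_B.differentiable two_ne_zero
  have hgrad : Integrable fun x => gradNorm (fun i x => u x i) (fun i x => B x i) x ^ 2 := by
    refine (hgrad_u.add hgrad_B).congr (Filter.Eventually.of_forall fun x => ?_)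
    simp only [gradNorm_sq, Finset.sum_add_distrib, Pi.add_apply, gradNormSq,
      partialD_eq_pd (du x), partialD_eq_pd (dB x)]
  have hint : Integrable fun x =>
      fieldNorm (fun i x => u x i) (fun i x => B x i) x ^ (9 / 2 : ℝ) := by
    -- The joint length is at most ‖u‖ + ‖B‖, which lies in L^(9/2).
    have h1 : MemLp (fieldNorm (fun i x => u x i) (fun i x => B x i)) (9 / 2 : ℝ≥0∞) volume := by
      refine (hu_int.norm.add hB_int.norm).mono h.continuous_fieldNorm.aestronglyMeasurable
        (Filter.Eventually.of_forall fun x => ?_)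
      rw [Real.norm_of_nonneg fieldNorm_nonneg, Pi.add_apply,
        Real.norm_of_nonneg (by positivity), fieldNorm, Real.sqrt_le_left (by positivity)]
      simp only [Finset.sum_add_distrib, ← norm_sq_eq_sum]
      nlinarith [norm_nonneg (u x), norm_nonneg (B x)]
    have h2 := h1.integrable_norm_rpow (ENNReal.div_pos (by norm_num) (by norm_num)).ne'
      (ENNReal.div_ne_top (by norm_num) (by norm_num))
    refine h2.congr (Filter.Eventually.of_forall fun x => ?_)
    simp only [Real.norm_of_nonneg fieldNorm_nonneg]
    norm_num
  have hz := h.gradient_eq_zero hν hgrad hint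
  exact ⟨eq_zero_of_partialD_eq_zero du
      (fun i j x => by rw [partialD_eq_pd (du x)]; exact (hz i j x).1) hu_int,
    eq_zero_of_partialD_eq_zero dB
      (fun i j x => by rw [partialD_eq_pd (dB x)]; exact (hz i j x).2) hB_int⟩
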